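/- For a field $K$ and an integer $d \ge 1$, let $\Gamma^*(d, K)$ denote the least integer $N$ such that for every $s \ge N$ and all $a_1, \dots, a_s \in K$, the additive form $$a_1x_1^d + a_2x_2^d + \cdots + a_sx_s^d$$ has a nontrivial zero, i.e. there is $(x_1, \dots, x_s) \in K^s$, not all $x_i$ zero, at which the form vanishes (with $\Gamma^*(d,K) = \infty$ if no such $N$ exists). **Theorem.** Let $d = 2m$ with $m$ odd and $m \ge 3$, and let $K = \mathbb{Q}_2(\sqrt{5})$ be the unramified quadratic extension of the field $\mathbb{Q}_2$ of $2$-adic numbers. 1. If $3 \nmid d$, then $\Gamma^*(d, K) = \frac{3}{2}d + 1$. 2. If $3 \mid d$, then $3d + 1 \le \Gamma^*(d, K) \le 4d + 1$. -/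

import Mathlib

/-- `5` is not a square in the field `ℚ_[2]` of `2`-adic numbers. -/
theorem padic_two_sq_ne_five (r : ℚ_[2]) : r ^ 2 ≠ 5 := by
  intro h
  have hn : ‖r‖ ≤ 1 := by
    have h5 : ‖(5 : ℚ_[2])‖ ≤ 1 := by
      have h5 := Padic.norm_int_le_one (p := 2) 5
      simpa using h5
    rw [← h, norm_pow] at h5
    exact (pow_le_one_iff_of_nonneg (norm_nonneg r) two_ne_zero).mp h5
  let z : ℤ_[2] := ⟨r, hn⟩
  have hz : z ^ 2 = 5 := by
    apply PadicInt.ext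
    push_cast
    exact h
  have h8 := congrArg (PadicInt.toZModPow (p := 2) 3) hz
  rw [map_pow, map_ofNat] at h8
  revert h8
  generalize PadicInt.toZModPow (p := 2) 3 z = y
  revert y
  decide

instance fact_sq_ne_five : Fact (∀ r : ℚ_[2], r ^ 2 ≠ 5 + 0 * r) :=
  ⟨fun r => by simpa using padic_two_sq_ne_five r⟩

/-- The field `ℚ₂(√5)`: pairs `x + y √5` with `x, y ∈ ℚ₂`, multiplied by the rule `(√5)² = 5`.
It is a field because `5` is not a square in `ℚ₂`. -/
abbrev Q2Sqrt5 : Type := QuadraticAlgebra ℚ_[2] 5 0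

/-- The additive form `a₁ x₁ ^ d + ⋯ + aₛ xₛ ^ d` has a nontrivial zero over `K`. -/
def HasNontrivialZero {K : Type*} [Field K] (d : ℕ) {s : ℕ} (a : Fin s → K) : Prop :=
  ∃ x : Fin s → K, x ≠ 0 ∧ ∑ i, a i * x i ^ d = 0

/-- `Γ*(d, K)`: the least `N` such that every additive form of degree `d` over `K` in at least
`N` variables has a nontrivial zero (`⊤` if there is no such `N`). -/
noncomputable def gammaStar (d : ℕ) (K : Type*) [Field K] : ℕ∞ :=
  sInf {n : ℕ∞ | ∃ N : ℕ, n = N ∧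
    ∀ s : ℕ, N ≤ s → ∀ a : Fin s → K, HasNontrivialZero d a}

/-! Let `O = ℤ₂[φ]`, with uniformizer `2` and residue field `F₄`. By Hensel's lemma a unit congruent
to `1` or `5` modulo `8` is a `d`-th power (`exists_pow_eq`); if `3 ∤ m`, the same holds for these
classes times powers of `φ²` (`liftsToPowers_squareResidues₃`). A zero sum modulo `8` in which every
variable contributes `0` or such a class lifts to a nontrivial zero as soon as a unit coefficient
takes part, because its variable can absorb the error (`SubsetSum.represents`). Finding zeros among
a few coefficients `2 ^ k u` is thus a finite problem in `O / 8`, settled by exhaustive search.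

Upper bounds. Up to `d`-th powers the exponent (level) of `2` in a coefficient matters only modulo
`d`. After a cyclic shift, the first `t` levels contain at least `s t / d` of the `s` coefficients
for every `t ≤ d` (`exists_levels`). So the first four levels hold cumulatively at least `5, 9, 13,
17` coefficients if `s > 4d`, and `2, 4, 5, 7` if `s > 3d/2`. In both cases this suffices
(`represents_of_levels`, `represents_of_levels₃`). Besides the searches, the argument contracts two
coefficients of one level whose combination is twice a unit into one coefficient of the next level.

Lower bounds. Take the sum over `j < m` of `4 ^ j g`, with `g` an additive form in `r` variables for
each `j`. A term in block `j` has valuation `2 (j + m k)`, so terms of least valuation share the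
same `j`, and all others vanish modulo `4` after division. A zero would therefore give a nontrivial
zero of `g` modulo `4` (`not_sum_eq_zero`). For `3 ∤ m` the unit `d`-th powers modulo `4` are `1,
φ², φ⁴` and `g` has coefficients `1, 1, 1 + 2φ`; for `3 ∣ m` the only one is `1`, and `1, 1, 1, φ,
φ, φ` works. -/

/-- The ring of integers `ℤ₂[φ]`, `φ² = 1 + φ`, of `ℚ₂(√5)`. -/
abbrev GoldenInt : Type := QuadraticAlgebra ℤ_[2] 1 1

/-- The residue ring `ℤ₂[φ] / 8`. -/
abbrev GoldenMod : Type := QuadraticAlgebra (ZMod 8) 1 1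

/-! ### Units and reduction modulo `8` in `ℤ₂[φ]`. -/

namespace GoldenInt

open QuadraticAlgebra

/-- Reduction modulo `8`. -/
noncomputable def red : GoldenInt →+* GoldenMod where
  toFun z := ⟨(PadicInt.toZModPow 3 : ℤ_[2] →+* ZMod 8) z.re,
    (PadicInt.toZModPow 3 : ℤ_[2] →+* ZMod 8) z.im⟩
  map_zero' := by ext <;> simp
  map_one' := by ext <;> simp [re_one, im_one]
  map_add' x y := by ext <;> simp
  map_mul' x y := by ext <;> simp

theorem two_dvd_iff {z : GoldenInt} {n : ℕ} :
    (2 : GoldenInt) ^ n ∣ z ↔ (2 : ℤ_[2]) ^ n ∣ z.re ∧ (2 : ℤ_[2]) ^ n ∣ z.im := by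
  have h : (2 : GoldenInt) ^ n = algebraMap ℤ_[2] GoldenInt (2 ^ n) := by
    rw [map_pow, map_ofNat]
  rw [h, algebraMap_dvd_iff]

theorem red_eq_zero_iff {z : GoldenInt} : red z = 0 ↔ (8 : GoldenInt) ∣ z := by
  have h8 : (8 : GoldenInt) = 2 ^ 3 := by norm_num
  have key : ∀ x : ℤ_[2], (PadicInt.toZModPow 3 : ℤ_[2] →+* ZMod 8) x = 0 ↔ (2 : ℤ_[2]) ^ 3 ∣ x := by
    intro x
    have := PadicInt.ker_toZModPow (p := 2) 3
    rw [← Ideal.mem_span_singleton]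
    have h2 : (Ideal.span {(2 : ℤ_[2]) ^ 3}) = RingHom.ker (PadicInt.toZModPow (p := 2) 3) := by
      rw [this]; norm_num
    rw [h2, RingHom.mem_ker]
  rw [h8, two_dvd_iff, ← key, ← key]
  constructor
  · intro h
    exact ⟨congrArg QuadraticAlgebra.re h, congrArg QuadraticAlgebra.im h⟩
  · rintro ⟨h1, h2⟩
    exact QuadraticAlgebra.ext h1 h2

theorem red_eq_iff {z w : GoldenInt} : red z = red w ↔ (8 : GoldenInt) ∣ z - w := by
  rw [← red_eq_zero_iff, map_sub, sub_eq_zero]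

theorem red_surjective : Function.Surjective red := by
  intro q
  refine ⟨⟨(q.re.val : ℤ_[2]), (q.im.val : ℤ_[2])⟩, ?_⟩
  ext
  · change (PadicInt.toZModPow 3 : ℤ_[2] →+* ZMod 8) _ = _
    rw [map_natCast, ZMod.natCast_zmod_val]
  · change (PadicInt.toZModPow 3 : ℤ_[2] →+* ZMod 8) _ = _
    rw [map_natCast, ZMod.natCast_zmod_val]

theorem not_isUnit_two : ¬ IsUnit (2 : ℤ_[2]) := by
  have := PadicInt.prime_p (p := 2)
  exact_mod_cast this.not_isUnit

theorem isUnit_of_two_dvd_sub_one {x : ℤ_[2]} (h : (2 : ℤ_[2]) ∣ x - 1) : IsUnit x := by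
  by_contra hx
  have h1 : (2 : ℤ_[2]) ∣ x := by
    have := PadicInt.mem_nonunits.1 hx
    rw [PadicInt.norm_lt_one_iff_dvd] at this
    exact_mod_cast this
  have : (2 : ℤ_[2]) ∣ 1 := by simpa using dvd_sub h1 h
  exact not_isUnit_two (isUnit_of_dvd_one this)

/-- The elements of `GoldenMod` that are units. -/
def IsOdd (q : GoldenMod) : Prop := 4 * q ≠ 0

instance : DecidablePred IsOdd := fun q => inferInstanceAs (Decidable (4 * q ≠ 0))

theorem forall_goldenMod {P : GoldenMod → Prop} (h : ∀ x y : ZMod 8, P ⟨x, y⟩) (q : GoldenMod) :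
    P q := h q.re q.im

theorem IsOdd.exists_inv {q : GoldenMod} (hq : IsOdd q) : ∃ r, q * r = 1 := by
  have : ∀ x y : ZMod 8, IsOdd ⟨x, y⟩ → ∃ x' y' : ZMod 8, (⟨x, y⟩ : GoldenMod) * ⟨x', y'⟩ = 1 := by
    decide +kernel
  obtain ⟨x', y', h⟩ := this q.re q.im hq
  exact ⟨⟨x', y'⟩, h⟩

theorem isUnit_of_two_dvd_sub {z : GoldenInt} (h : (2 : GoldenInt) ∣ z - 1) : IsUnit z := by
  rw [isUnit_iff_norm_isUnit]
  apply isUnit_of_two_dvd_sub_one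
  obtain ⟨w, hw⟩ := h
  rw [sub_eq_iff_eq_add] at hw
  subst hw
  refine ⟨2 * w.re + w.re * w.im * 2 + 2 * w.re ^ 2 - 2 * w.im ^ 2 + w.im, ?_⟩
  simp [norm_def, re_one, im_one]
  ring

theorem isUnit_iff_isOdd {z : GoldenInt} : IsUnit z ↔ IsOdd (red z) := by
  constructor
  · intro h h0
    obtain ⟨w, hw⟩ := h.exists_right_inv
    have h1 : (4 : GoldenMod) = 0 := by
      have := congrArg red hw
      rw [map_mul, map_one] at this
      calc (4 : GoldenMod) = 4 * red z * red w := by rw [mul_assoc, this, mul_one]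
        _ = 0 := by rw [h0, zero_mul]
    revert h1
    decide
  · intro h
    obtain ⟨r, hr⟩ := h.exists_inv
    obtain ⟨w, rfl⟩ := red_surjective r
    have h1 : (8 : GoldenInt) ∣ z * w - 1 := by
      rw [← red_eq_iff, map_mul, map_one, hr]
    have h2 : IsUnit (z * w) := isUnit_of_two_dvd_sub (dvd_trans ⟨4, by norm_num⟩ h1)
    exact isUnit_of_mul_isUnit_left h2

/-! ### Completeness, Hensel lifting and `2m`-th powers. -/

theorem padicInt_exists_limit (s : ℕ → ℤ_[2]) (hs : ∀ n, (2 : ℤ_[2]) ^ n ∣ s (n + 1) - s n) :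
    ∃ l, ∀ n, (2 : ℤ_[2]) ^ n ∣ l - s n := by
  have hmn : ∀ m k, (2 : ℤ_[2]) ^ m ∣ s (m + k) - s m := by
    intro m k
    induction k with
    | zero => simp
    | succ k ih =>
      have h1 : (2 : ℤ_[2]) ^ m ∣ s (m + k + 1) - s (m + k) :=
        dvd_trans (pow_dvd_pow 2 (Nat.le_add_right m k)) (hs (m + k))
      have := dvd_add h1 ih
      rwa [sub_add_sub_cancel] at this
  have hI : ∀ (n : ℕ) (x y : ℤ_[2]),
      x ≡ y [SMOD (IsLocalRing.maximalIdeal ℤ_[2] ^ n • ⊤ : Submodule ℤ_[2] ℤ_[2])] ↔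
        (2 : ℤ_[2]) ^ n ∣ x - y := by
    intro n x y
    rw [SModEq.sub_mem, PadicInt.maximalIdeal_eq_span_p, Ideal.span_singleton_pow,
      smul_eq_mul, Ideal.mul_top, Ideal.mem_span_singleton]
    norm_num
  obtain ⟨l, hl⟩ := IsPrecomplete.prec
    (inferInstance : IsPrecomplete (IsLocalRing.maximalIdeal ℤ_[2]) ℤ_[2]) (f := s) (by
      intro m n hmn'
      rw [hI]
      obtain ⟨k, rfl⟩ := Nat.exists_eq_add_of_le hmn'
      rw [← neg_sub, dvd_neg]
      exact hmn m k)
  refine ⟨l, fun n => ?_⟩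
  rw [← neg_sub, dvd_neg, ← hI]
  exact hl n

theorem exists_limit (s : ℕ → GoldenInt) (hs : ∀ n, (2 : GoldenInt) ^ n ∣ s (n + 1) - s n) :
    ∃ l, ∀ n, (2 : GoldenInt) ^ n ∣ l - s n := by
  obtain ⟨a, ha⟩ := padicInt_exists_limit (fun n => (s n).re) fun n => by
    simpa using (two_dvd_iff.1 (hs n)).1
  obtain ⟨b, hb⟩ := padicInt_exists_limit (fun n => (s n).im) fun n => by
    simpa using (two_dvd_iff.1 (hs n)).2
  exact ⟨⟨a, b⟩, fun n => two_dvd_iff.2 ⟨by simpa using ha n, by simpa using hb n⟩⟩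

theorem padicInt_eq_zero_of_forall_dvd {x : ℤ_[2]} (h : ∀ n : ℕ, (2 : ℤ_[2]) ^ n ∣ x) : x = 0 := by
  by_contra hx
  have h2 : (2 : ℤ_[2]) ^ (x.valuation + 1) ∣ x := h _
  have h3 := (PadicInt.norm_le_pow_iff_mem_span_pow x (x.valuation + 1)).2 (by
    rw [Ideal.mem_span_singleton]; exact_mod_cast h2)
  rw [PadicInt.norm_le_pow_iff_le_valuation x hx] at h3
  omega

theorem eq_zero_of_forall_dvd {z : GoldenInt} (h : ∀ n : ℕ, (2 : GoldenInt) ^ n ∣ z) : z = 0 :=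
  QuadraticAlgebra.ext (padicInt_eq_zero_of_forall_dvd fun n => (two_dvd_iff.1 (h n)).1)
    (padicInt_eq_zero_of_forall_dvd fun n => (two_dvd_iff.1 (h n)).2)

/-- A contraction of a residue class modulo `2` has a fixed point there. -/
theorem exists_fixedPoint (T : GoldenInt → GoldenInt) (y₀ : GoldenInt) (h₀ : 2 ∣ T y₀ - y₀)
    (hT : ∀ y z, 2 ∣ y - y₀ → 2 ∣ z - y₀ → 2 * (y - z) ∣ T y - T z) :
    ∃ y, 2 ∣ y - y₀ ∧ T y = y := by
  have hstep : ∀ n, 2 ∣ T^[n] y₀ - y₀ := by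
    intro n
    induction n with
    | zero => simp
    | succ n ih =>
      rw [Function.iterate_succ_apply']
      have h1 := dvd_trans (Dvd.intro _ rfl) (hT _ _ ih (by simp : (2 : GoldenInt) ∣ y₀ - y₀))
      have := dvd_add h1 h₀
      rwa [sub_add_sub_cancel] at this
  have hs : ∀ n, (2 : GoldenInt) ^ (n + 1) ∣ T^[n + 1] y₀ - T^[n] y₀ := by
    intro n
    induction n with
    | zero => simpa using h₀
    | succ n ih =>
      rw [Function.iterate_succ_apply' T (n + 1), Function.iterate_succ_apply' T n]
      have h1 := hT _ _ (hstep (n + 1)) (hstep n)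
      rw [Function.iterate_succ_apply' T n] at h1 ih
      refine dvd_trans ?_ h1
      rw [pow_succ']
      exact mul_dvd_mul_left 2 ih
  obtain ⟨l, hl⟩ := exists_limit (fun n => T^[n] y₀)
    fun n => dvd_trans (pow_dvd_pow 2 (Nat.le_succ n)) (hs n)
  have hl0 : 2 ∣ l - y₀ := by
    have h1 : (2 : GoldenInt) ∣ l - T^[1] y₀ := by simpa using hl 1
    have := dvd_add h1 (hstep 1)
    rwa [sub_add_sub_cancel] at this
  refine ⟨l, hl0, ?_⟩
  rw [← sub_eq_zero]
  apply eq_zero_of_forall_dvd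
  intro n
  have h1 : (2 : GoldenInt) ^ n ∣ T l - T (T^[n] y₀) :=
    dvd_trans (hl n) (dvd_trans (Dvd.intro_left _ rfl) (hT _ _ hl0 (hstep n)))
  have h2 : (2 : GoldenInt) ^ n ∣ T (T^[n] y₀) - l := by
    have h3 := hl (n + 1)
    simp only [Function.iterate_succ_apply'] at h3
    rw [← neg_sub, dvd_neg]
    exact dvd_trans (pow_dvd_pow 2 (Nat.le_succ n)) h3
  have := dvd_add h1 h2
  rwa [sub_add_sub_cancel] at this

/-- A root is a fixed point of `w ↦ w + z - w ^ m`. On the class of `1` this is a contraction, since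
`(y ^ m - y' ^ m) / (y - y')` is a sum of `m` terms congruent to `1`, hence odd. -/
theorem exists_pow_eq_of_odd {m : ℕ} (hm : Odd m) {z : GoldenInt} (hz : 2 ∣ z - 1) :
    ∃ w, 2 ∣ w - 1 ∧ w ^ m = z := by
  obtain ⟨w, hw, h⟩ := exists_fixedPoint (fun w => w + z - w ^ m) 1 (by simpa using hz) (by
    intro y y' hy hy'
    have h1 : y + z - y ^ m - (y' + z - y' ^ m)
        = (1 - ∑ i ∈ Finset.range m, y ^ i * y' ^ (m - 1 - i)) * (y - y') := by
      rw [sub_mul, one_mul, Commute.geom_sum₂_mul (Commute.all y y')]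
      ring
    simp only [h1]
    apply mul_dvd_mul_right
    have h2 : ∀ i ∈ Finset.range m, (2 : GoldenInt) ∣ y ^ i * y' ^ (m - 1 - i) - 1 := by
      intro i _
      have ha : (2 : GoldenInt) ∣ y ^ i - 1 := dvd_trans hy (by simpa using sub_dvd_pow_sub_pow y 1 i)
      have hb : (2 : GoldenInt) ∣ y' ^ (m - 1 - i) - 1 :=
        dvd_trans hy' (by simpa using sub_dvd_pow_sub_pow y' 1 (m - 1 - i))
      have h3 : y ^ i * y' ^ (m - 1 - i) - 1
          = (y ^ i - 1) * y' ^ (m - 1 - i) + (y' ^ (m - 1 - i) - 1) := by ring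
      rw [h3]
      exact dvd_add (dvd_mul_of_dvd_left ha _) hb
    have h4 := Finset.dvd_sum h2
    rw [Finset.sum_sub_distrib] at h4
    simp only [Finset.sum_const, Finset.card_range, nsmul_eq_mul, mul_one] at h4
    obtain ⟨k, rfl⟩ := hm
    have h5 : (2 : GoldenInt) ∣ ((2 * k + 1 : ℕ) : GoldenInt) - 1 := ⟨k, by push_cast; ring⟩
    have h6 := dvd_add h4 h5
    rw [sub_add_sub_cancel] at h6
    rw [← neg_sub, dvd_neg]
    exact h6)
  exact ⟨w, hw, by linear_combination (exp := 1) -h⟩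

/-- As `(1 + 2y)² = 1 + 4 (y + y²)`, one solves `y + y² = c` by iterating `y ↦ c - y²`. A start
modulo `2` exists because `y + y²` takes the values `0` and `1` on `F₄`. -/
theorem exists_sq_eq {c : GoldenInt} (hc : 2 ∣ c ∨ 2 ∣ c - 1) :
    ∃ w, 2 ∣ w - 1 ∧ w ^ 2 = 1 + 4 * c := by
  have : ∃ y₀ : GoldenInt, 2 ∣ c - y₀ ^ 2 - y₀ := by
    rcases hc with hc | hc
    · exact ⟨0, by simpa using hc⟩
    -- The start is `φ`, with `φ² + φ = 1 + 2φ`.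
    · refine ⟨⟨0, 1⟩, ?_⟩
      have h1 : (⟨0, 1⟩ : GoldenInt) ^ 2 = 1 + ⟨0, 1⟩ := by
        rw [sq]; ext <;> simp [re_one, im_one]
      rw [h1, show c - (1 + (⟨0, 1⟩ : GoldenInt)) - ⟨0, 1⟩ = (c - 1) - 2 * ⟨0, 1⟩ by ring]
      exact dvd_sub hc (Dvd.intro _ rfl)
  obtain ⟨y₀, hy₀⟩ := this
  obtain ⟨y, hy, h⟩ := exists_fixedPoint (fun y => c - y ^ 2) y₀ hy₀ (by
    intro y z hy hz
    have h1 : c - y ^ 2 - (c - z ^ 2) = ((z - y₀) - (y - y₀) - 2 * (z - y₀) - 2 * y₀) * (y - z) := by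
      ring
    simp only [h1]
    apply mul_dvd_mul_right
    exact dvd_sub (dvd_sub (dvd_sub hz hy) (Dvd.intro _ rfl)) (Dvd.intro _ rfl))
  refine ⟨1 + 2 * y, ⟨y, by ring⟩, ?_⟩
  linear_combination (exp := 1) (-4 : GoldenInt) * h

/-- Units congruent to `1` or `5` modulo `8` are `2m`-th powers for `m` odd. -/
theorem exists_pow_eq {m : ℕ} (hm : Odd m) {u : GoldenInt} (hu : red u = 1 ∨ red u = 5) :
    ∃ w, w ^ (2 * m) = u := by
  have : ∃ c : GoldenInt, (2 ∣ c ∨ 2 ∣ c - 1) ∧ u = 1 + 4 * c := by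
    rcases hu with hu | hu
    · rw [← map_one red, red_eq_iff] at hu
      obtain ⟨k, hk⟩ := hu
      exact ⟨2 * k, Or.inl (Dvd.intro _ rfl), by linear_combination hk⟩
    · rw [← map_ofNat red 5, red_eq_iff] at hu
      obtain ⟨k, hk⟩ := hu
      exact ⟨1 + 2 * k, Or.inr ⟨k, by ring⟩, by linear_combination hk⟩
  obtain ⟨c, hc, rfl⟩ := this
  obtain ⟨w, hw, h⟩ := exists_sq_eq hc
  obtain ⟨v, -, hv⟩ := exists_pow_eq_of_odd hm hw
  exact ⟨v, by rw [mul_comm, pow_mul, hv, h]⟩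

/-! ### The embedding into `ℚ₂(√5)` and valuations. -/

/-- The inclusion of the ring of integers into `ℚ₂(√5)`, with `φ ↦ (1 + √5) / 2`. -/
noncomputable def toField : GoldenInt →+* Q2Sqrt5 where
  toFun z := ⟨z.re + z.im / 2, z.im / 2⟩
  map_zero' := by ext <;> simp
  map_one' := by ext <;> simp [re_one, im_one]
  map_add' x y := by ext <;> simp <;> ring
  map_mul' x y := by ext <;> simp <;> ring

theorem toField_injective : Function.Injective toField := by
  intro x y h
  have h1 : (x.re : ℚ_[2]) + x.im / 2 = y.re + y.im / 2 := congrArg QuadraticAlgebra.re h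
  have h2 : (x.im : ℚ_[2]) / 2 = y.im / 2 := congrArg QuadraticAlgebra.im h
  have h3 : (x.im : ℚ_[2]) = y.im := by linear_combination 2 * h2
  have h4 : (x.re : ℚ_[2]) = y.re := by linear_combination h1 - h2
  exact QuadraticAlgebra.ext (Subtype.coe_injective h4) (Subtype.coe_injective h3)

instance : IsDomain GoldenInt := toField_injective.isDomain toField

theorem exists_two_pow_mul {z : GoldenInt} (hz : z ≠ 0) :
    ∃ (n : ℕ) (u : GoldenInt), IsUnit u ∧ z = 2 ^ n * u := by
  have h1 : ∃ n : ℕ, ¬ (2 : GoldenInt) ^ (n + 1) ∣ z := by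
    by_contra! h
    exact hz (eq_zero_of_forall_dvd fun n => dvd_trans (pow_dvd_pow 2 (Nat.le_succ n)) (h n))
  classical
  have hn := Nat.find_spec h1
  have hd : (2 : GoldenInt) ^ Nat.find h1 ∣ z := by
    rcases Nat.eq_zero_or_pos (Nat.find h1) with h0 | h0
    · rw [h0]; simp
    · have := Nat.find_min h1 (Nat.sub_lt h0 one_pos)
      rwa [not_not, Nat.sub_add_cancel (show 1 ≤ Nat.find h1 from h0)] at this
  obtain ⟨u, hu⟩ := hd
  refine ⟨_, u, ?_, hu⟩
  rw [isUnit_iff_isOdd]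
  intro h4
  apply hn
  have h5 : red (4 * u) = 0 := by rw [map_mul, map_ofNat]; exact h4
  rw [red_eq_zero_iff] at h5
  obtain ⟨v, hv⟩ := h5
  have h6 : u = 2 * v := by
    apply mul_left_cancel₀ (show (4 : GoldenInt) ≠ 0 by norm_num)
    rw [hv]; ring
  refine ⟨v, ?_⟩
  rw [pow_succ, mul_assoc, ← h6]
  exact hu

/-- Every nonzero element of `ℚ₂(√5)` is a power of `2` times a unit. -/
theorem exists_zpow_mul {x : Q2Sqrt5} (hx : x ≠ 0) :
    ∃ (n : ℤ) (u : GoldenInt), IsUnit u ∧ x = 2 ^ n * toField u := by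
  have key : ∀ t : ℚ_[2], ∃ n : ℕ, ∀ k, n ≤ k → ∃ z : ℤ_[2], (z : ℚ_[2]) = 2 ^ k * t := by
    intro t
    obtain ⟨n, hn⟩ := exists_nat_gt (Real.logb 2 ‖t‖)
    have h2 : ‖(2 : ℚ_[2])‖ = 2⁻¹ := by simpa using Padic.norm_p (p := 2)
    refine ⟨n, fun k hk => ⟨⟨2 ^ k * t, ?_⟩, rfl⟩⟩
    rw [norm_mul, norm_pow, h2, inv_pow, inv_mul_le_iff₀ (by positivity), mul_one]
    rcases eq_or_lt_of_le (norm_nonneg t) with h0 | h0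
    · rw [← h0]; positivity
    · have := (Real.logb_lt_iff_lt_rpow (by norm_num) h0).1 hn
      rw [Real.rpow_natCast] at this
      exact this.le.trans (pow_le_pow_right₀ (by norm_num) hk)
  -- The coordinates of `x` in the basis `1, φ` are `x.re - x.im` and `2 * x.im`, because `√5 = 2φ -
  -- 1`.
  obtain ⟨n₁, h₁⟩ := key (x.re - x.im)
  obtain ⟨n₂, h₂⟩ := key (2 * x.im)
  obtain ⟨a, ha⟩ := h₁ (n₁ + n₂) (Nat.le_add_right _ _)
  obtain ⟨b, hb⟩ := h₂ (n₁ + n₂) (Nat.le_add_left _ _)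
  have hab : toField ⟨a, b⟩ = 2 ^ (n₁ + n₂) * x := by
    have h2 : (2 : Q2Sqrt5) ^ (n₁ + n₂) = algebraMap ℚ_[2] Q2Sqrt5 (2 ^ (n₁ + n₂)) := by
      rw [map_pow, map_ofNat]
    rw [h2]
    ext
    · change (a : ℚ_[2]) + b / 2 = _
      simp [ha, hb, algebraMap_eq]
      ring
    · change (b : ℚ_[2]) / 2 = _
      simp [hb, algebraMap_eq]
      ring
  have h20 : (2 : Q2Sqrt5) ≠ 0 := two_ne_zero
  have h0 : (⟨a, b⟩ : GoldenInt) ≠ 0 := by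
    intro h
    rw [h, map_zero] at hab
    exact (mul_ne_zero (pow_ne_zero _ h20) hx) hab.symm
  obtain ⟨k, u, hu, hk⟩ := exists_two_pow_mul h0
  refine ⟨(k : ℤ) - ((n₁ + n₂ : ℕ) : ℤ), u, hu, ?_⟩
  rw [hk, map_mul, map_pow, map_ofNat] at hab
  rw [zpow_sub₀ h20, zpow_natCast, zpow_natCast, div_mul_eq_mul_div, hab,
    mul_div_cancel_left₀ _ (pow_ne_zero _ h20)]

end GoldenInt

/-! ### Values represented by additive forms. -/

section Represents

variable {A : Type*} [CommRing A] {d : ℕ}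

/-- The additive form of degree `d` with coefficients `P` takes the value `e`, at a nonzero vector
if `b` is true. -/
def Represents (d : ℕ) (P : Multiset A) (b : Bool) (e : A) : Prop :=
  ∃ X : Multiset (A × A), X.map Prod.fst = P ∧ (b = true → ∃ p ∈ X, p.2 ≠ 0) ∧
    (X.map fun p => p.1 * p.2 ^ d).sum = e

namespace Represents

theorem zero (hd : d ≠ 0) (P : Multiset A) : Represents d P false 0 := by
  refine ⟨P.map fun p => (p, 0), by simp, by simp, ?_⟩
  simp [zero_pow hd]

theorem add {P P' : Multiset A} {b b' : Bool} {e e' : A} (h : Represents d P b e)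
    (h' : Represents d P' b' e') : Represents d (P + P') (b || b') (e + e') := by
  obtain ⟨X, h1, h2, h3⟩ := h
  obtain ⟨X', h1', h2', h3'⟩ := h'
  refine ⟨X + X', by simp [h1, h1'], fun hb => ?_, by simp [h3, h3']⟩
  rw [Bool.or_eq_true] at hb
  rcases hb with hb | hb
  · obtain ⟨p, hp, hp0⟩ := h2 hb
    exact ⟨p, Multiset.mem_add.2 (Or.inl hp), hp0⟩
  · obtain ⟨p, hp, hp0⟩ := h2' hb
    exact ⟨p, Multiset.mem_add.2 (Or.inr hp), hp0⟩

theorem singleton (p x : A) : Represents d {p} false (p * x ^ d) :=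
  ⟨{(p, x)}, by simp, by simp, by simp⟩

theorem singleton_of_ne (p : A) {x : A} (hx : x ≠ 0) : Represents d {p} true (p * x ^ d) :=
  ⟨{(p, x)}, by simp, fun _ => ⟨(p, x), by simp, hx⟩, by simp⟩

theorem mul [NoZeroDivisors A] {P : Multiset A} {b : Bool} {e : A} (h : Represents d P b e) {y : A}
    (hy : y ≠ 0) : Represents d P b (e * y ^ d) := by
  obtain ⟨X, h1, h2, h3⟩ := h
  refine ⟨X.map fun p => (p.1, p.2 * y), by simpa using h1, fun hb => ?_, ?_⟩
  · obtain ⟨p, hp, hp0⟩ := h2 hb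
    exact ⟨_, Multiset.mem_map_of_mem _ hp, mul_ne_zero hp0 hy⟩
  · rw [← h3, Multiset.map_map, ← Multiset.sum_map_mul_right]
    refine congrArg _ (Multiset.map_congr rfl fun p _ => ?_)
    simp only [Function.comp_apply, mul_pow]
    ring

theorem of_le (hd : d ≠ 0) {P P' : Multiset A} {e : A} (h : Represents d P true e) (hP : P ≤ P') :
    Represents d P' true e := by
  obtain ⟨R, rfl⟩ := Multiset.le_iff_exists_add.1 hP
  simpa using h.add (zero hd R)

/-- Replacing some coefficients by a value they take does not create zeros. -/
theorem contract [NoZeroDivisors A] (hd : d ≠ 0) {N M : Multiset A} {e f : A}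
    (hN : Represents d N true e) (h : Represents d (e ::ₘ M) true f) :
    Represents d (N + M) true f := by
  classical
  obtain ⟨X, h1, h2, h3⟩ := h
  obtain ⟨p, hp, hpe, hX⟩ := (Multiset.map_eq_cons Prod.fst X M e).2 h1
  obtain ⟨Y, rfl⟩ := Multiset.exists_cons_of_mem hp
  simp only [Multiset.erase_cons_head] at hX
  simp only [Multiset.map_cons, Multiset.sum_cons, hpe] at h3
  -- If the variable at `e` is zero, the nonzero one lies in `M`; otherwise it scales the nonzero
  -- vector representing `e` by `N`.
  by_cases hx : p.2 = 0
  · rw [hx, zero_pow hd, mul_zero] at h3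
    rw [← h3]
    have hM : Represents d M true (Y.map fun p => p.1 * p.2 ^ d).sum := by
      refine ⟨Y, hX, fun _ => ?_, rfl⟩
      obtain ⟨q, hq, hq0⟩ := h2 rfl
      rcases Multiset.mem_cons.1 hq with rfl | hq
      · exact absurd hx hq0
      · exact ⟨q, hq, hq0⟩
    simpa using (zero hd N).add hM
  · rw [← h3]
    have hM : Represents d M false (Y.map fun p => p.1 * p.2 ^ d).sum := ⟨Y, hX, by simp, rfl⟩
    simpa using (hN.mul hx).add hM

theorem map {B : Type*} [CommRing B] {P : Multiset A} {b : Bool} {e : A} (h : Represents d P b e)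
    {f : A →+* B} (hf : Function.Injective f) : Represents d (P.map f) b (f e) := by
  obtain ⟨X, h1, h2, h3⟩ := h
  refine ⟨X.map (Prod.map f f), ?_, fun hb => ?_, ?_⟩
  · rw [← h1, Multiset.map_map, Multiset.map_map]
    rfl
  · obtain ⟨p, hp, hp0⟩ := h2 hb
    exact ⟨_, Multiset.mem_map_of_mem _ hp, (map_ne_zero_iff f hf).2 hp0⟩
  · rw [← h3, map_multiset_sum, Multiset.map_map, Multiset.map_map]
    refine congrArg _ (Multiset.map_congr rfl fun p _ => ?_)
    simp

theorem mul_left {P : Multiset A} {b : Bool} {e : A} (h : Represents d P b e) (c : A) :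
    Represents d (P.map (c * ·)) b (c * e) := by
  obtain ⟨X, h1, h2, h3⟩ := h
  refine ⟨X.map fun p => (c * p.1, p.2), ?_, fun hb => ?_, ?_⟩
  · rw [← h1, Multiset.map_map, Multiset.map_map]
    rfl
  · obtain ⟨p, hp, hp0⟩ := h2 hb
    exact ⟨_, Multiset.mem_map_of_mem _ hp, hp0⟩
  · rw [← h3, Multiset.map_map, ← Multiset.sum_map_mul_left]
    refine congrArg _ (Multiset.map_congr rfl fun p _ => ?_)
    simp only [Function.comp_apply]
    ring

theorem of_isUnit_mul {P : Multiset A} {b : Bool} {c : A} (hc : IsUnit c)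
    (h : Represents d (P.map (c * ·)) b 0) : Represents d P b 0 := by
  obtain ⟨u, hu⟩ := hc.exists_left_inv
  have := h.mul_left u
  rw [Multiset.map_map, mul_zero] at this
  have h1 : (fun x => u * x) ∘ (fun x => c * x) = id := by
    funext x
    simp [← mul_assoc, hu]
  rwa [h1, Multiset.map_id] at this

end Represents

end Represents

/-! ### Sums modulo `8` and their lifts. -/

open GoldenInt

/-- `SubsetSum C P b e`: a sum `∑ c_p p` over `p ∈ P`, with `c_p = 0` or `c_p ∈ C`, equals `e`;
here `b` tells whether some `c_p` with `p` odd is nonzero. -/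
inductive SubsetSum (C : List GoldenMod) : Multiset GoldenMod → Bool → GoldenMod → Prop
  | nil : SubsetSum C 0 false 0
  | skip (p : GoldenMod) {P : Multiset GoldenMod} {b : Bool} {e : GoldenMod} :
      SubsetSum C P b e → SubsetSum C (p ::ₘ P) b e
  | take (p : GoldenMod) {P : Multiset GoldenMod} {b : Bool} {e c : GoldenMod} (hc : c ∈ C) :
      SubsetSum C P b e → SubsetSum C (p ::ₘ P) (b || decide (IsOdd p)) (e + c * p)

/-- Every lift of an element of `C` is a `d`-th power. -/
def LiftsToPowers (d : ℕ) (C : List GoldenMod) : Prop :=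
  (∀ c ∈ C, IsOdd c) ∧ ∀ u : GoldenInt, red u ∈ C → ∃ w, w ^ d = u

theorem LiftsToPowers.exists_ne_zero {d : ℕ} (hd : d ≠ 0) {C : List GoldenMod}
    (hC : LiftsToPowers d C) {u : GoldenInt} (hu : red u ∈ C) : ∃ w, w ≠ 0 ∧ w ^ d = u := by
  obtain ⟨w, hw⟩ := hC.2 u hu
  refine ⟨w, ?_, hw⟩
  rintro rfl
  have := hC.1 _ hu
  rw [← isUnit_iff_isOdd, ← hw, zero_pow hd] at this
  exact not_isUnit_zero this

/-- The induction needs both halves: some lift of `e` is always a value, and every lift is one once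
an odd coefficient is used. For the first odd coefficient `q`, with `E` the value of the other
terms, `F = q y ^ d + E` asks that `q⁻¹ (F - E)` be a `d`-th power, which holds because its
reduction is in `C`. Afterwards the freedom is inherited. -/
theorem SubsetSum.represents {d : ℕ} (hd : d ≠ 0) {C : List GoldenMod} (hC : LiftsToPowers d C)
    {P : Multiset GoldenMod} {b : Bool} {e : GoldenMod} (h : SubsetSum C P b e) :
    ∀ N : Multiset GoldenInt, N.map red = P →
      (∃ E, red E = e ∧ Represents d N false E) ∧
      (b = true → ∀ E, red E = e → Represents d N true E) := by
  classical
  induction h with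
  | nil =>
    intro N hN
    rw [Multiset.map_eq_zero] at hN
    subst hN
    exact ⟨⟨0, map_zero _, Represents.zero hd 0⟩, by simp⟩
  | skip p _ ih =>
    intro N hN
    obtain ⟨q, hq, hqp, hN⟩ := (Multiset.map_eq_cons red N _ p).2 hN
    obtain ⟨⟨E, hE, h1⟩, h2⟩ := ih _ hN
    rw [← Multiset.cons_erase hq, ← Multiset.singleton_add]
    refine ⟨⟨E, hE, ?_⟩, fun hb E hE => ?_⟩
    · simpa using (Represents.zero hd {q}).add h1
    · simpa using (Represents.zero hd {q}).add (h2 hb E hE)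
  | @take p _ b e c hc _ ih =>
    intro N hN
    obtain ⟨q, hq, hqp, hN⟩ := (Multiset.map_eq_cons red N _ p).2 hN
    obtain ⟨⟨E, hE, h1⟩, h2⟩ := ih _ hN
    obtain ⟨u, rfl⟩ := red_surjective c
    obtain ⟨w, hw0, hw⟩ := hC.exists_ne_zero hd hc
    rw [← Multiset.cons_erase hq, ← Multiset.singleton_add]
    refine ⟨⟨q * w ^ d + E, ?_, ?_⟩, fun hb F hF => ?_⟩
    · rw [map_add, map_mul, hE, hqp, hw]; ring
    · simpa using (Represents.singleton q w).add h1
    · by_cases hb' : b = true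
      · have h3 := h2 hb' (F - q * w ^ d) (by rw [map_sub, map_mul, hqp, hw, hF]; ring)
        simpa using (Represents.singleton q w).add h3
      · have hp : IsOdd p := by simpa [hb'] using hb
        rw [← hqp, ← isUnit_iff_isOdd] at hp
        obtain ⟨v, hv⟩ := hp.exists_left_inv
        obtain ⟨y, hy0, hy⟩ := hC.exists_ne_zero hd (u := v * (F - E)) (by
          have h3 : red v * p = 1 := by rw [← hqp, ← map_mul, hv, map_one]
          rw [map_mul, map_sub, hF, hE]
          rwa [show red v * (e + red u * p - e) = red u * (red v * p) by ring, h3, mul_one])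
        have h3 : F = q * y ^ d + E := by
          rw [hy, ← mul_assoc, mul_comm q v, hv]; ring
        rw [h3]
        simpa using (Represents.singleton_of_ne q hy0).add h1

/-! ### Searching for subset sums with bit masks -/

namespace SumSearch

/-- The bits of the mask that stand for elements of `GoldenMod`. -/
def lowMask : ℕ := 0x00FF00FF00FF00FF00FF00FF00FF00FF

/-- Reduce the exponents of a shifted mask modulo `8` in both directions. -/
def wrap (m : ℕ) : ℕ :=
  -- Shifting by `8` also moves the columns below `8` of a row into the columns from `8` on of the
  -- preceding row; `lowMask` discards these.
  (fun m' => Nat.land (Nat.lor m' (Nat.shiftRight m' 128)) lowMask) (Nat.lor m (Nat.shiftRight m 8))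

/-- Translate the set with mask `n` by the element with code `k`. -/
def translate (n k : ℕ) : ℕ := wrap (Nat.shiftLeft n k)

/-- Join the mask `acc` with the translates of `n` by the elements with codes in `ks`. -/
def joinTranslates (acc n : ℕ) (ks : List ℕ) : ℕ :=
  List.rec acc (fun k _ ih => Nat.lor (translate n k) ih) ks

/-- The element with code `16 x + y` is `x + y φ`. -/
def decode (k : ℕ) : GoldenMod := ⟨(k / 16 : ℕ), (k % 16 : ℕ)⟩

/-- One layer of the search, over the candidates `cs` for the next summand. -/
def node (odd : Bool) (rec : ℕ → ℕ → List (List ℕ) → Bool) (R L : ℕ) (cs : List (List ℕ)) : Bool :=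
  List.rec true (fun c cs ih =>
    (fun S => bif (bif Nat.beq (Nat.land S 1) 1 then true else
      -- The next layer keeps `c` but no earlier candidate, so multisets are enumerated in the order
      -- of the list.
      rec S (bif odd then L else joinTranslates L L c) (c :: cs)) then ih else false)
    (joinTranslates R (bif odd then Nat.lor R L else R) c)) cs

/-- Search through all multisets of `n` candidates: is a sum equal to zero, or does `leaf` hold? -/
def search (odd : Bool) (leaf : ℕ → ℕ → Bool) (n : ℕ) : ℕ → ℕ → List (List ℕ) → Bool :=
  Nat.rec (fun R L _ => leaf R L) (fun _ ih => node odd ih) n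

/-- All elements of the set with mask `n` have the property `S`. -/
def MaskSound (n : ℕ) (S : GoldenMod → Prop) : Prop :=
  ∀ i, n.testBit i = true → i % 16 < 8 ∧ S (decode i)

theorem lowMask_testBit {i : ℕ} (h : lowMask.testBit i = true) : i % 16 < 8 := by
  have hi : i < 128 := by
    by_contra hi
    rw [Nat.testBit_lt_two_pow] at h
    · simp at h
    · exact lt_of_lt_of_le (by decide : lowMask < 2 ^ 128) (Nat.pow_le_pow_right (by norm_num) (by omega))
  have : ∀ i < 128, lowMask.testBit i = true → i % 16 < 8 := by decide
  exact this i hi h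

/-- Two columns below `8` add up to less than `16`, so rows never overflow into each other; `x` and
`y` count the reductions by `8` in the two coordinates. -/
theorem decode_add {i j k c x y : ℕ} (hi : i % 16 < 8) (hj : j % 16 < 8) (hk : k % 16 < 8)
    (hc : c = 128 * x + 8 * y) (hy : y < 2) (h : i + c = j + k) :
    decode i = decode j + decode k := by
  have h8 : (8 : ZMod 8) = 0 := by decide
  have h1 : i / 16 + 8 * x = j / 16 + k / 16 := by omega
  have h2 : i % 16 + 8 * y = j % 16 + k % 16 := by omega
  have h1' := congrArg (Nat.cast : ℕ → ZMod 8) h1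
  have h2' := congrArg (Nat.cast : ℕ → ZMod 8) h2
  simp only [Nat.cast_add, Nat.cast_mul, Nat.cast_ofNat, h8, zero_mul, add_zero] at h1' h2'
  exact QuadraticAlgebra.ext h1' h2'

theorem MaskSound.translate {n k : ℕ} {S : GoldenMod → Prop} (h : MaskSound n S) (hk : k % 16 < 8) :
    MaskSound (translate n k) fun e => ∃ e₀, S e₀ ∧ e = e₀ + decode k := by
  intro i hi
  have hi' : ((((n <<< k) ||| ((n <<< k) >>> 8)) ||| (((n <<< k) ||| ((n <<< k) >>> 8)) >>> 128)) &&&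
      lowMask).testBit i = true := hi
  rw [Nat.testBit_and, Bool.and_eq_true] at hi'
  have hlow := lowMask_testBit hi'.2
  refine ⟨hlow, ?_⟩
  have hb := hi'.1
  simp only [Nat.testBit_or, Nat.testBit_shiftRight, Nat.testBit_shiftLeft, Bool.or_eq_true,
    Bool.and_eq_true, decide_eq_true_eq] at hb
  rcases hb with (⟨hk', hb⟩ | ⟨hk', hb⟩) | (⟨hk', hb⟩ | ⟨hk', hb⟩)
  · obtain ⟨h1, h2⟩ := h _ hb
    exact ⟨_, h2, decode_add (c := 0) (x := 0) (y := 0) hlow h1 hk rfl (by norm_num) (by omega)⟩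
  · obtain ⟨h1, h2⟩ := h _ hb
    exact ⟨_, h2, decode_add (c := 8) (x := 0) (y := 1) hlow h1 hk rfl (by norm_num) (by omega)⟩
  · obtain ⟨h1, h2⟩ := h _ hb
    exact ⟨_, h2, decode_add (c := 128) (x := 1) (y := 0) hlow h1 hk rfl (by norm_num) (by omega)⟩
  · obtain ⟨h1, h2⟩ := h _ hb
    exact ⟨_, h2, decode_add (c := 136) (x := 1) (y := 1) hlow h1 hk rfl (by norm_num) (by omega)⟩

theorem MaskSound.mono {n : ℕ} {S T : GoldenMod → Prop} (h : MaskSound n S) (hST : ∀ e, S e → T e) :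
    MaskSound n T := fun i hi => ⟨(h i hi).1, hST _ (h i hi).2⟩

theorem MaskSound.lor {m n : ℕ} {S : GoldenMod → Prop} (hm : MaskSound m S) (hn : MaskSound n S) :
    MaskSound (Nat.lor m n) S := by
  intro i hi
  have : (m ||| n).testBit i = true := hi
  rw [Nat.testBit_or, Bool.or_eq_true] at this
  exact this.elim (hm i) (hn i)

/-- The codes `ks` stand for multiples of `p` by elements of `C`. -/
def Codes (C : List GoldenMod) (ks : List ℕ) (p : GoldenMod) : Prop :=
  ∀ k ∈ ks, k % 16 < 8 ∧ ∃ c ∈ C, decode k = c * p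

instance (C : List GoldenMod) (ks : List ℕ) (p : GoldenMod) : Decidable (Codes C ks p) :=
  inferInstanceAs (Decidable (∀ k ∈ ks, k % 16 < 8 ∧ ∃ c ∈ C, decode k = c * p))

theorem MaskSound.joinTranslates {acc n : ℕ} {S T : GoldenMod → Prop} {C : List GoldenMod}
    {p : GoldenMod} (hacc : MaskSound acc T) (hn : MaskSound n S)
    (hST : ∀ e c, c ∈ C → S e → T (e + c * p)) :
    ∀ ks : List ℕ, Codes C ks p → MaskSound (joinTranslates acc n ks) T
  | [], _ => hacc
  | k :: ks, h => by
    obtain ⟨hk, c, hc, hkc⟩ := h k List.mem_cons_self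
    refine MaskSound.lor ((hn.translate hk).mono ?_) (MaskSound.joinTranslates hacc hn hST ks
      fun k' hk' => h k' (List.mem_cons_of_mem _ hk'))
    rintro e ⟨e₀, he₀, rfl⟩
    rw [hkc]
    exact hST _ _ hc he₀

/-- The masks `R`, `L` stand for sums with, respectively without, an odd summand. -/
def Inv (C : List GoldenMod) (P : Multiset GoldenMod) (R L : ℕ) : Prop :=
  MaskSound R (SubsetSum C P true) ∧ MaskSound L (SubsetSum C P false)

theorem Inv.zero (C : List GoldenMod) : Inv C 0 0 1 := by
  constructor
  · intro i hi
    simp at hi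
  · intro i hi
    rw [Nat.testBit_one_eq_true_iff_self_eq_zero] at hi
    subst hi
    exact ⟨by norm_num, SubsetSum.nil⟩

theorem Inv.step {C : List GoldenMod} {P : Multiset GoldenMod} {R L : ℕ} (h : Inv C P R L)
    {odd : Bool} {p : GoldenMod} (hp : odd = decide (IsOdd p)) {ks : List ℕ} (hks : Codes C ks p) :
    Inv C (p ::ₘ P) (joinTranslates R (bif odd then Nat.lor R L else R) ks)
      (bif odd then L else joinTranslates L L ks) := by
  have hR : MaskSound R (SubsetSum C (p ::ₘ P) true) := h.1.mono fun e he => he.skip p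
  have hL : MaskSound L (SubsetSum C (p ::ₘ P) false) := h.2.mono fun e he => he.skip p
  cases odd with
  | true =>
    refine ⟨?_, hL⟩
    refine MaskSound.joinTranslates (S := fun e => ∃ b, SubsetSum C P b e) hR
      (MaskSound.lor (h.1.mono fun e he => ⟨_, he⟩) (h.2.mono fun e he => ⟨_, he⟩)) ?_ ks hks
    rintro e c hc ⟨b, he⟩
    simpa [← hp] using he.take p hc
  | false =>
    refine ⟨MaskSound.joinTranslates hR h.1 ?_ ks hks, MaskSound.joinTranslates hL h.2 ?_ ks hks⟩
    · intro e c hc he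
      simpa [← hp] using he.take p hc
    · intro e c hc he
      simpa [← hp] using he.take p hc

theorem Inv.dead {C : List GoldenMod} {P : Multiset GoldenMod} {R L : ℕ} (h : Inv C P R L)
    (hR : Nat.beq (Nat.land R 1) 1 = true) : SubsetSum C P true 0 := by
  have h1 : R &&& 1 = 1 := Nat.eq_of_beq_eq_true hR
  have h2 : R.testBit 0 = true := by
    rw [Nat.testBit_zero]
    rw [Nat.and_one_is_mod] at h1
    simpa using h1
  have h3 := (h.1 0 h2).2
  have h4 : decode 0 = 0 := by decide
  rwa [h4] at h3

theorem subsetSum_add {C : List GoldenMod} {P : Multiset GoldenMod} {b : Bool} {e : GoldenMod}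
    (h : SubsetSum C P b e) (M : Multiset GoldenMod) : SubsetSum C (P + M) b e := by
  induction M using Multiset.induction_on with
  | empty => simpa using h
  | cons p M ih =>
    rw [Multiset.add_cons]
    exact ih.skip p

/-- A successful search finds a zero sum, unless `leaf` holds. -/
theorem search_sound {C : List GoldenMod} {odd : Bool} {leaf : ℕ → ℕ → Bool} (n : ℕ) :
    ∀ (P M : Multiset GoldenMod) (R L : ℕ) (cs : List (List ℕ)), Inv C P R L →
      M.card = n → (∀ p ∈ M, odd = decide (IsOdd p) ∧ ∃ ks ∈ cs, Codes C ks p) →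
      search odd leaf n R L cs = true →
      SubsetSum C (P + M) true 0 ∨ ∃ R' L', Inv C (P + M) R' L' ∧ leaf R' L' = true := by
  induction n with
  | zero =>
    intro P M R L cs h hM _ hs
    rw [Multiset.card_eq_zero] at hM
    subst hM
    rw [add_zero]
    exact Or.inr ⟨R, L, h, hs⟩
  | succ n ih =>
    intro P M R L cs h hM hcs hs
    change node odd (search odd leaf n) R L cs = true at hs
    induction cs with
    | nil =>
      obtain ⟨p, hp⟩ := Multiset.card_pos_iff_exists_mem.1 (by omega : 0 < M.card)
      obtain ⟨-, ks, hks, -⟩ := hcs p hp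
      simp at hks
    | cons c cs ihc =>
      change (bif (bif Nat.beq (Nat.land (joinTranslates R (bif odd then Nat.lor R L else R) c) 1) 1
        then true else search odd leaf n (joinTranslates R (bif odd then Nat.lor R L else R) c)
        (bif odd then L else joinTranslates L L c) (c :: cs))
        then node odd (search odd leaf n) R L cs else false) = true at hs
      rw [Bool.cond_false_right, Bool.and_eq_true] at hs
      -- Either some remaining summand has the codes `c` and is taken next, or `c` can leave the
      -- list of candidates.
      by_cases hc : ∃ p ∈ M, Codes C c p
      · obtain ⟨p, hp, hcp⟩ := hc
        obtain ⟨M', rfl⟩ := Multiset.exists_cons_of_mem hp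
        have hstep := h.step (hcs p hp).1 hcp
        rw [show P + p ::ₘ M' = (p ::ₘ P) + M' by
          rw [Multiset.add_cons, Multiset.cons_add]]
        rw [Multiset.card_cons, Nat.add_right_cancel_iff] at hM
        have hs1 := hs.1
        rw [Bool.cond_true_left, Bool.or_eq_true] at hs1
        rcases hs1 with hs1 | hs1
        · exact Or.inl (subsetSum_add (hstep.dead hs1) M')
        · exact ih _ M' _ _ _ hstep hM (fun q hq => hcs q (Multiset.mem_cons_of_mem hq)) hs1
      · refine ihc (fun p hp => ⟨(hcs p hp).1, ?_⟩) hs.2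
        obtain ⟨ks, hks, h'⟩ := (hcs p hp).2
        rcases List.mem_cons.1 hks with rfl | hks
        · exact absurd ⟨p, hp, h'⟩ hc
        · exact ⟨ks, hks, h'⟩

/-- A search in stages, each with a number of summands of fixed parity and their candidates. -/
def searchStages : List (Bool × ℕ × List (List ℕ)) → ℕ → ℕ → Bool
  | [] => fun _ _ => false
  | s :: ss => fun R L => search s.1 (searchStages ss) s.2.1 R L s.2.2

theorem searchStages_sound {C : List GoldenMod} {ss : List (Bool × ℕ × List (List ℕ))}
    {Ms : List (Multiset GoldenMod)}
    (h : List.Forall₂ (fun s M => M.card = s.2.1 ∧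
      ∀ p ∈ M, s.1 = decide (IsOdd p) ∧ ∃ ks ∈ s.2.2, Codes C ks p) ss Ms)
    {P : Multiset GoldenMod} {R L : ℕ} (hI : Inv C P R L) (hs : searchStages ss R L = true) :
    SubsetSum C (P + Ms.sum) true 0 := by
  induction h generalizing P R L with
  | nil => exact absurd hs Bool.false_ne_true
  | cons h1 _ ih =>
    rename_i M _ Ms _
    rw [List.sum_cons, ← add_assoc]
    rcases search_sound _ P M R L _ hI h1.1 h1.2 hs with h2 | ⟨R', L', hI', hl⟩
    · exact subsetSum_add h2 _
    · exact ih hI' hl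

theorem subsetSum_of_searchStages {C : List GoldenMod} {ss : List (Bool × ℕ × List (List ℕ))}
    (hs : searchStages ss 0 1 = true) {Ms : List (Multiset GoldenMod)}
    (h : List.Forall₂ (fun s M => M.card = s.2.1 ∧
      ∀ p ∈ M, s.1 = decide (IsOdd p) ∧ ∃ ks ∈ s.2.2, Codes C ks p) ss Ms) :
    SubsetSum C Ms.sum true 0 := by
  simpa using searchStages_sound h (Inv.zero C) hs

/-- Codes of the units modulo `8` up to multiplication by `1, 5`. -/
def unitCodes : List (List ℕ) :=
  [[1, 5], [3, 7], [16, 80], [17, 85], [18, 82], [19, 87], [20, 84], [21, 81], [22, 86], [23, 83],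
    [33, 37], [35, 39], [48, 112], [49, 117], [50, 114], [51, 119], [52, 116], [53, 113],
    [54, 118], [55, 115], [65, 69], [67, 71], [97, 101], [99, 103]]

/-- Codes of twice the units. -/
def doubleCodes : List (List ℕ) :=
  [[2], [6], [32], [34], [36], [38], [66], [70], [96], [98], [100], [102]]

/-- Codes of twice the units that are not `± 1` modulo `4`. -/
def doubleCodes' : List (List ℕ) := [[2], [6], [34], [36], [38], [66], [70], [98], [100], [102]]

/-- Codes of the units congruent to `± 1` modulo `4`. -/
def signCodes : List (List ℕ) := [[16, 80], [20, 84], [48, 112], [52, 116]]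

/-- Codes of the units congruent to `1` modulo `2`. -/
def principalCodes : List (List ℕ) :=
  [[16, 80], [18, 82], [20, 84], [22, 86], [48, 112], [50, 114], [52, 116], [54, 118]]

/-- Codes of the units modulo `8` up to multiplication by `1, 5` and the powers of `φ ^ 2`. -/
def unitCodes₃ : List (List ℕ) :=
  [[1, 5, 18, 53, 82, 113], [3, 7, 23, 54, 83, 118], [16, 17, 35, 39, 80, 85],
    [19, 50, 67, 71, 87, 114], [20, 21, 81, 84, 99, 103], [22, 49, 65, 69, 86, 117],
    [33, 37, 52, 55, 115, 116], [48, 51, 97, 101, 112, 119]]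

/-- Codes of twice the units up to the powers of `φ ^ 2`. -/
def doubleCodes₃ : List (List ℕ) := [[2, 36, 98], [6, 38, 100], [32, 34, 70], [66, 96, 102]]

end SumSearch

/-- The residues `1, 5`. -/
def squareResidues : List GoldenMod := [1, 5]

/-- The residues `1, 5` times powers of `φ ^ 2`. -/
def squareResidues₃ : List GoldenMod := [1, ⟨1, 1⟩, ⟨2, 3⟩, 5, ⟨5, 5⟩, ⟨2, 7⟩]

/-! ### The finite verifications modulo `8`. -/

namespace SumSearch

theorem codes_unit : ∀ q, IsOdd q → ∃ ks ∈ unitCodes, Codes squareResidues ks q :=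
  forall_goldenMod (by decide +kernel)

theorem codes_double :
    ∀ q, IsOdd q → ¬ IsOdd (2 * q) ∧ ∃ ks ∈ doubleCodes, Codes squareResidues ks (2 * q) :=
  forall_goldenMod (by decide +kernel)

theorem codes_double' : ∀ q, IsOdd q → ¬ (2 * q = 2 ∨ 2 * q = -2) →
    ¬ IsOdd (2 * q) ∧ ∃ ks ∈ doubleCodes', Codes squareResidues ks (2 * q) :=
  forall_goldenMod (by decide +kernel)

theorem codes_double_sign : ∀ q, (2 * q = 2 ∨ 2 * q = -2) →
    ¬ IsOdd (2 * q) ∧ ∃ ks ∈ [[32], [96]], Codes squareResidues ks (2 * q) :=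
  forall_goldenMod (by decide +kernel)

theorem codes_double_principal : ∀ q, 4 * q = 4 →
    ¬ IsOdd (2 * q) ∧ ∃ ks ∈ [[32], [96], [36], [100]], Codes squareResidues ks (2 * q) :=
  forall_goldenMod (by decide +kernel)

theorem codes_sign : ∀ q, (2 * q = 2 ∨ 2 * q = -2) →
    IsOdd q ∧ ∃ ks ∈ signCodes, Codes squareResidues ks q :=
  forall_goldenMod (by decide +kernel)

theorem codes_principal : ∀ q, 4 * q = 4 →
    IsOdd q ∧ ∃ ks ∈ principalCodes, Codes squareResidues ks q :=
  forall_goldenMod (by decide +kernel)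

theorem codes_quadruple : ∀ q, IsOdd q → 4 * q ≠ 4 →
    ¬ IsOdd (4 * q) ∧ ∃ ks ∈ [[4], [68]], Codes squareResidues ks (4 * q) :=
  forall_goldenMod (by decide +kernel)

theorem codes_unit₃ : ∀ q, IsOdd q → ∃ ks ∈ unitCodes₃, Codes squareResidues₃ ks q :=
  forall_goldenMod (by decide +kernel)

theorem codes_double₃ :
    ∀ q, IsOdd q → ¬ IsOdd (2 * q) ∧ ∃ ks ∈ doubleCodes₃, Codes squareResidues₃ ks (2 * q) :=
  forall_goldenMod (by decide +kernel)

theorem codes_quadruple₃ :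
    ∀ q, IsOdd q → ¬ IsOdd (4 * q) ∧ ∃ ks ∈ [[4, 64, 68]], Codes squareResidues₃ ks (4 * q) :=
  forall_goldenMod (by decide +kernel)

/-- Some `c` makes `c * q` congruent to `1` modulo `2`. If `1 + c * q` is then not twice a unit, `c
* q` is `-1` modulo `4`, which leaves only the classes of `3` and `3 + 4φ`. -/
theorem codes_bad₃ : ∀ q, IsOdd q →
    (∀ c ∈ squareResidues₃, ¬ (4 * (1 + c * q) = 0 ∧ 2 * (1 + c * q) ≠ 0)) →
    ∃ ks ∈ [[33, 37, 52, 55, 115, 116], [48, 51, 97, 101, 112, 119]], Codes squareResidues₃ ks q :=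
  forall_goldenMod (by decide +kernel)

theorem search_seven : searchStages [(false, 1, [[32]]), (true, 7, unitCodes)] 0 1 = true := by
  decide +kernel

theorem search_distinct : searchStages [(false, 1, [[32]]), (false, 1, doubleCodes'),
    (true, 5, unitCodes), (false, 1, doubleCodes)] 0 1 = true := by
  decide +kernel

theorem search_quadruple : searchStages [(false, 1, [[32]]), (false, 2, [[32], [96]]),
    (false, 1, [[4], [68]]), (true, 5, unitCodes)] 0 1 = true := by
  decide +kernel

theorem search_sign_four : searchStages [(false, 1, [[32], [96], [36], [100]]),
    (true, 4, signCodes)] 0 1 = true := by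
  decide +kernel

theorem search_sign_five : searchStages [(true, 5, signCodes)] 0 1 = true := by
  decide +kernel

theorem search_principal_five : searchStages [(true, 5, principalCodes),
    (false, 2, doubleCodes)] 0 1 = true := by
  decide +kernel

theorem search_principal_seven : searchStages [(true, 7, principalCodes)] 0 1 = true := by
  decide +kernel

theorem search₃_five : searchStages [(true, 5, unitCodes₃)] 0 1 = true := by
  decide +kernel

theorem search₃_four' : searchStages [(false, 1, [[4, 64, 68]]), (true, 4, unitCodes₃)] 0 1 = true := by
  decide +kernel

theorem search₃_three : searchStages [(false, 1, doubleCodes₃), (true, 3, unitCodes₃)] 0 1 = true := by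
  decide +kernel

theorem search₃_two : searchStages [(true, 1, [[16, 17, 35, 39, 80, 85]]),
    (true, 1, [[33, 37, 52, 55, 115, 116], [48, 51, 97, 101, 112, 119]]),
    (false, 3, doubleCodes₃)] 0 1 = true := by
  decide +kernel

theorem search₃_two' : searchStages [(true, 1, [[16, 17, 35, 39, 80, 85]]),
    (true, 1, [[33, 37, 52, 55, 115, 116], [48, 51, 97, 101, 112, 119]]),
    (false, 2, doubleCodes₃), (false, 1, [[4, 64, 68]])] 0 1 = true := by
  decide +kernel

end SumSearch

open SumSearch

/-! ### Levels of coefficients and transfer of the searches to forms. -/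

theorem Multiset.exists_le_of_le_card {α : Type*} {s : Multiset α} {n : ℕ} (h : n ≤ s.card) :
    ∃ t ≤ s, t.card = n := by
  induction s using Quotient.inductionOn with
  | h l => exact ⟨(l.take n : List α), (List.take_sublist n l).subperm, by simpa using h⟩

theorem Multiset.exists_cons_of_card_pos {α : Type*} {s : Multiset α} (h : 0 < s.card) :
    ∃ a t, s = a ::ₘ t := by
  obtain ⟨a, ha⟩ := Multiset.card_pos_iff_exists_mem.1 h
  exact ⟨a, Multiset.exists_cons_of_mem ha⟩

/-- The coefficients `2 ^ k u` for `u ∈ S`. -/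
noncomputable def levelCoeffs (k : ℕ) (S : Multiset GoldenInt) : Multiset GoldenInt :=
  S.map (2 ^ k * ·)

theorem levelCoeffs_zero (S : Multiset GoldenInt) : levelCoeffs 0 S = S := by
  simp [levelCoeffs]

theorem levelCoeffs_add (k : ℕ) (S T : Multiset GoldenInt) :
    levelCoeffs k (S + T) = levelCoeffs k S + levelCoeffs k T := Multiset.map_add _ _ _

theorem levelCoeffs_singleton (k : ℕ) (u : GoldenInt) : levelCoeffs k {u} = {2 ^ k * u} :=
  Multiset.map_singleton _ _

theorem levelCoeffs_le {k : ℕ} {S T : Multiset GoldenInt} (h : S ≤ T) :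
    levelCoeffs k S ≤ levelCoeffs k T := Multiset.map_le_map h

theorem map_levelCoeffs (k l : ℕ) (S : Multiset GoldenInt) :
    (levelCoeffs l S).map (2 ^ k * ·) = levelCoeffs (k + l) S := by
  rw [levelCoeffs, Multiset.map_map]
  refine Multiset.map_congr rfl fun u _ => ?_
  simp only [Function.comp_apply]
  ring

theorem GoldenInt.eight_mul_red (u : GoldenMod) : 8 * u = 0 := by
  have : (8 : GoldenMod) = 0 := by decide
  rw [this, zero_mul]

/-- Congruence modulo `4` up to sign. -/
def SameSign (u v : GoldenInt) : Prop := 2 * red u = 2 * red v ∨ 2 * red u = -(2 * red v)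

/-- Congruence modulo `2`. -/
def SameResidue (u v : GoldenInt) : Prop := 4 * red u = 4 * red v

theorem SameSign.sameResidue {u v : GoldenInt} (h : SameSign u v) : SameResidue u v := by
  have h8 := eight_mul_red (red v)
  rcases h with h | h
  · unfold SameResidue; linear_combination 2 * h
  · unfold SameResidue; linear_combination 2 * h - h8

section Search

variable {d : ℕ} {C : List GoldenMod} {ss : List (Bool × ℕ × List (List ℕ))}

theorem represents_zero_of_search (hd : d ≠ 0) (hC : LiftsToPowers d C)
    (hs : searchStages ss 0 1 = true) {Ms : List (Multiset GoldenInt)}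
    (h : List.Forall₂ (fun s M => M.card = s.2.1 ∧
      ∀ p ∈ M, s.1 = decide (IsOdd (red p)) ∧ ∃ ks ∈ s.2.2, Codes C ks (red p)) ss Ms) :
    Represents d Ms.sum true 0 := by
  have h1 : SubsetSum C (Ms.map (Multiset.map red)).sum true 0 := by
    apply subsetSum_of_searchStages hs
    rw [List.forall₂_map_right_iff]
    refine h.imp fun s M hM => ⟨by simpa using hM.1, ?_⟩
    intro p hp
    obtain ⟨q, hq, rfl⟩ := Multiset.mem_map.1 hp
    exact hM.2 q hq
  refine (h1.represents hd hC Ms.sum ?_).2 rfl 0 (map_zero _)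
  exact map_list_sum (Multiset.mapAddMonoidHom red) Ms

/-- The search applied to a form that has been multiplied by a unit. -/
theorem represents_zero_of_search_mul (hd : d ≠ 0) (hC : LiftsToPowers d C)
    (hs : searchStages ss 0 1 = true) {Ms : List (Multiset GoldenInt)} {w : GoldenInt}
    (hw : IsUnit w)
    (h : List.Forall₂ (fun s M => M.card = s.2.1 ∧ ∀ p ∈ M,
      s.1 = decide (IsOdd (red w * red p)) ∧ ∃ ks ∈ s.2.2, Codes C ks (red w * red p)) ss Ms) :
    Represents d Ms.sum true 0 := by
  apply Represents.of_isUnit_mul hw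
  have h1 : Ms.sum.map (w * ·) = (Ms.map (Multiset.map (w * ·))).sum :=
    map_list_sum (Multiset.mapAddMonoidHom (w * ·)) Ms
  rw [h1]
  apply represents_zero_of_search hd hC hs
  rw [List.forall₂_map_right_iff]
  refine h.imp fun s M hM => ⟨by simpa using hM.1, ?_⟩
  intro p hp
  obtain ⟨q, hq, rfl⟩ := Multiset.mem_map.1 hp
  rw [map_mul]
  exact hM.2 q hq

/-- Zeros of the part of a form with coefficients in levels `k` and above. -/
theorem Represents.shift {P : Multiset GoldenInt} (h : Represents d P true 0) (k : ℕ) :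
    Represents d (P.map (2 ^ k * ·)) true 0 := by
  simpa using h.mul_left (2 ^ k)

end Search

theorem IsOdd.mul {p q : GoldenMod} (hp : IsOdd p) (hq : IsOdd q) : IsOdd (p * q) := by
  obtain ⟨u, rfl⟩ := red_surjective p
  obtain ⟨v, rfl⟩ := red_surjective q
  rw [← isUnit_iff_isOdd] at hp hq
  rw [← map_mul, ← isUnit_iff_isOdd]
  exact hp.mul hq

section Stages

variable {C : List GoldenMod}

theorem stage_unit {css : List (List ℕ)} (hcs : ∀ q, IsOdd q → ∃ ks ∈ css, Codes C ks q)
    {n : ℕ} {U : Multiset GoldenInt} (hn : U.card = n) (hU : ∀ u ∈ U, IsUnit u) {w : GoldenInt}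
    (hw : IsUnit w) : U.card = n ∧ ∀ p ∈ U, true = decide (IsOdd (red w * red p)) ∧
      ∃ ks ∈ css, Codes C ks (red w * red p) := by
  refine ⟨hn, fun p hp => ?_⟩
  have : IsOdd (red w * red p) := IsOdd.mul (isUnit_iff_isOdd.1 hw) (isUnit_iff_isOdd.1 (hU p hp))
  exact ⟨by simpa using this, hcs _ this⟩

theorem stage_even {css : List (List ℕ)} {k : ℕ} {T : GoldenMod → Prop}
    (hcs : ∀ q, T q → ¬ IsOdd (2 ^ k * q) ∧ ∃ ks ∈ css, Codes C ks (2 ^ k * q))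
    {n : ℕ} {U : Multiset GoldenInt} (hn : U.card = n) {w : GoldenInt}
    (hU : ∀ u ∈ U, T (red w * red u)) :
    (levelCoeffs k U).card = n ∧ ∀ p ∈ levelCoeffs k U, false = decide (IsOdd (red w * red p)) ∧
      ∃ ks ∈ css, Codes C ks (red w * red p) := by
  refine ⟨by simpa [levelCoeffs] using hn, fun p hp => ?_⟩
  obtain ⟨u, hu, rfl⟩ := Multiset.mem_map.1 hp
  have h1 : red w * red (2 ^ k * u) = 2 ^ k * (red w * red u) := by
    rw [map_mul, map_pow, map_ofNat]; ring
  rw [h1]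
  obtain ⟨h2, h3⟩ := hcs _ (hU u hu)
  exact ⟨by simpa using h2, h3⟩

theorem isOdd_red_mul {w u : GoldenInt} (hw : IsUnit w) (hu : IsUnit u) :
    IsOdd (red w * red u) := IsOdd.mul (isUnit_iff_isOdd.1 hw) (isUnit_iff_isOdd.1 hu)

end Stages

theorem codes_two : ∀ q : GoldenMod, q = 1 →
    ¬ IsOdd (2 ^ 1 * q) ∧ ∃ ks ∈ [[32]], Codes squareResidues ks (2 ^ 1 * q) := by
  rintro _ rfl
  decide +kernel

/-! ### Zeros of special forms, using the power classes `1, 5`. -/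

section SquareResidues

variable {d : ℕ}

/-- Here and below the form is first divided by a unit `v`, which normalizes its classes: in
`search_seven` the coefficient of level one is just `2`. -/
theorem represents_seven (hd : d ≠ 0) (hC : LiftsToPowers d squareResidues)
    {U V : Multiset GoldenInt} (hU : ∀ u ∈ U, IsUnit u) (hV : ∀ u ∈ V, IsUnit u)
    (hU7 : 7 ≤ U.card) (hV1 : 1 ≤ V.card) : Represents d (U + levelCoeffs 1 V) true 0 := by
  obtain ⟨U', hU', hc⟩ := Multiset.exists_le_of_le_card hU7
  obtain ⟨v, V', rfl⟩ := Multiset.exists_cons_of_card_pos hV1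
  obtain ⟨w, hw⟩ := (hV v (Multiset.mem_cons_self _ _)).exists_left_inv
  have hwu : IsUnit w := IsUnit.of_mul_eq_one _ hw
  have hrw : red w * red v = 1 := by rw [← map_mul, hw, map_one]
  have := represents_zero_of_search_mul hd hC search_seven hwu
    (Ms := [levelCoeffs 1 {v}, U'])
    (.cons (stage_even codes_two (Multiset.card_singleton _) (by simpa using hrw))
      (.cons (stage_unit codes_unit hc (fun u hu => hU u (Multiset.mem_of_le hU' hu)) hwu) .nil))
  refine this.of_le hd ?_
  simp only [List.sum_cons, List.sum_nil, add_zero]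
  rw [add_comm]
  exact add_le_add hU' (levelCoeffs_le (by simp))

theorem represents_distinct (hd : d ≠ 0) (hC : LiftsToPowers d squareResidues)
    {U : Multiset GoldenInt} (hU : ∀ u ∈ U, IsUnit u) (hU5 : U.card = 5) {v x y : GoldenInt}
    (hv : IsUnit v) (hx : IsUnit x) (hy : IsUnit y) (hxv : ¬ SameSign x v) :
    Represents d (U + levelCoeffs 1 {v, x, y}) true 0 := by
  obtain ⟨w, hw⟩ := hv.exists_left_inv
  have hwu : IsUnit w := IsUnit.of_mul_eq_one _ hw
  have hrw : red w * red v = 1 := by rw [← map_mul, hw, map_one]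
  have := represents_zero_of_search_mul hd hC search_distinct hwu
    (Ms := [levelCoeffs 1 {v}, levelCoeffs 1 {x}, U, levelCoeffs 1 {y}])
    (.cons (stage_even codes_two (Multiset.card_singleton _) (by simpa using hrw))
      (.cons (stage_even (T := fun q => IsOdd q ∧ ¬ (2 * q = 2 ∨ 2 * q = -2))
          (fun q hq => by simpa using codes_double' q hq.1 hq.2) (Multiset.card_singleton _) (by
          simp only [Multiset.mem_singleton, forall_eq]
          refine ⟨isOdd_red_mul hwu hx, fun h => hxv ?_⟩
          rcases h with h | h
          · exact Or.inl (by linear_combination red v * h - 2 * red x * hrw)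
          · exact Or.inr (by linear_combination red v * h - 2 * red x * hrw)))
        (.cons (stage_unit codes_unit hU5 hU hwu)
          (.cons (stage_even (T := IsOdd) (fun q hq => by simpa using codes_double q hq)
            (Multiset.card_singleton _) (by simpa using isOdd_red_mul hwu hy)) .nil))))
  refine this.of_le hd (le_of_eq ?_)
  simp only [List.sum_cons, List.sum_nil, add_zero, Multiset.insert_eq_cons, levelCoeffs_add,
    ← Multiset.singleton_add]
  abel

theorem SameSign.mul {u v w : GoldenInt} (h : SameSign u v) (hrw : red w * red v = 1) :
    2 * (red w * red u) = 2 ∨ 2 * (red w * red u) = -2 := by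
  rcases h with h | h
  · exact Or.inl (by linear_combination red w * h + 2 * hrw)
  · exact Or.inr (by linear_combination red w * h - 2 * hrw)

theorem SameResidue.mul {u v w : GoldenInt} (h : SameResidue u v) (hrw : red w * red v = 1) :
    4 * (red w * red u) = 4 := by
  unfold SameResidue at h
  linear_combination red w * h + 4 * hrw

theorem represents_quadruple (hd : d ≠ 0) (hC : LiftsToPowers d squareResidues)
    {U : Multiset GoldenInt} (hU : ∀ u ∈ U, IsUnit u) (hU5 : U.card = 5) {v x y z : GoldenInt}
    (hv : IsUnit v) (hz : IsUnit z) (hxv : SameSign x v) (hyv : SameSign y v)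
    (hzv : ¬ SameResidue z v) :
    Represents d (U + levelCoeffs 1 {v, x, y} + levelCoeffs 2 {z}) true 0 := by
  obtain ⟨w, hw⟩ := hv.exists_left_inv
  have hwu : IsUnit w := IsUnit.of_mul_eq_one _ hw
  have hrw : red w * red v = 1 := by rw [← map_mul, hw, map_one]
  have := represents_zero_of_search_mul hd hC search_quadruple hwu
    (Ms := [levelCoeffs 1 {v}, levelCoeffs 1 {x, y}, levelCoeffs 2 {z}, U])
    (.cons (stage_even codes_two (Multiset.card_singleton _) (by simpa using hrw))
      (.cons (stage_even (T := fun q => 2 * q = 2 ∨ 2 * q = -2)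
          (fun q hq => by simpa using codes_double_sign q hq) (Multiset.card_pair _ _) (by
          intro u hu
          rcases Multiset.mem_cons.1 hu with rfl | hu
          · exact hxv.mul hrw
          · rw [Multiset.mem_singleton.1 hu]
            exact hyv.mul hrw))
        (.cons (stage_even (T := fun q => IsOdd q ∧ 4 * q ≠ 4)
          (fun q hq => by
            rw [show (2 : GoldenMod) ^ 2 = 4 by norm_num]
            exact codes_quadruple q hq.1 hq.2)
          (Multiset.card_singleton _) (by
          simp only [Multiset.mem_singleton, forall_eq]
          refine ⟨isOdd_red_mul hwu hz, fun h => hzv ?_⟩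
          unfold SameResidue
          linear_combination red v * h - 4 * red z * hrw))
          (.cons (stage_unit codes_unit hU5 hU hwu) .nil))))
  refine this.of_le hd (le_of_eq ?_)
  simp only [List.sum_cons, List.sum_nil, add_zero, Multiset.insert_eq_cons, levelCoeffs_add,
    ← Multiset.singleton_add]
  abel

theorem stage_special {css : List (List ℕ)} {T : GoldenMod → Prop}
    (hcs : ∀ q, T q → IsOdd q ∧ ∃ ks ∈ css, Codes squareResidues ks q)
    {n : ℕ} {U : Multiset GoldenInt} (hn : U.card = n) {w : GoldenInt}
    (hU : ∀ u ∈ U, T (red w * red u)) :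
    U.card = n ∧ ∀ p ∈ U, true = decide (IsOdd (red w * red p)) ∧
      ∃ ks ∈ css, Codes squareResidues ks (red w * red p) :=
  ⟨hn, fun p hp => ⟨by simpa using (hcs _ (hU p hp)).1, (hcs _ (hU p hp)).2⟩⟩

theorem represents_sign_four (hd : d ≠ 0) (hC : LiftsToPowers d squareResidues)
    {U : Multiset GoldenInt} {v z : GoldenInt} (hv : IsUnit v) (hU : ∀ u ∈ U, SameSign u v)
    (hU4 : 4 ≤ U.card) (hz : SameResidue z v) :
    Represents d (U + levelCoeffs 1 {z}) true 0 := by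
  obtain ⟨U', hU', hc⟩ := Multiset.exists_le_of_le_card hU4
  obtain ⟨w, hw⟩ := hv.exists_left_inv
  have hwu : IsUnit w := IsUnit.of_mul_eq_one _ hw
  have hrw : red w * red v = 1 := by rw [← map_mul, hw, map_one]
  have := represents_zero_of_search_mul hd hC search_sign_four hwu
    (Ms := [levelCoeffs 1 {z}, U'])
    (.cons (stage_even (T := fun q => 4 * q = 4)
        (fun q hq => by simpa using codes_double_principal q hq) (Multiset.card_singleton _)
        (by simpa using hz.mul hrw))
      (.cons (stage_special codes_sign hc
        fun u hu => (hU u (Multiset.mem_of_le hU' hu)).mul hrw) .nil))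
  refine this.of_le hd ?_
  simp only [List.sum_cons, List.sum_nil, add_zero]
  rw [add_comm]
  exact add_le_add hU' le_rfl

theorem represents_sign_five (hd : d ≠ 0) (hC : LiftsToPowers d squareResidues)
    {U : Multiset GoldenInt} {v : GoldenInt} (hv : IsUnit v) (hU : ∀ u ∈ U, SameSign u v)
    (hU5 : 5 ≤ U.card) : Represents d U true 0 := by
  obtain ⟨U', hU', hc⟩ := Multiset.exists_le_of_le_card hU5
  obtain ⟨w, hw⟩ := hv.exists_left_inv
  have hrw : red w * red v = 1 := by rw [← map_mul, hw, map_one]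
  have := represents_zero_of_search_mul hd hC search_sign_five (IsUnit.of_mul_eq_one _ hw)
    (Ms := [U'])
    (.cons (stage_special codes_sign hc
        fun u hu => (hU u (Multiset.mem_of_le hU' hu)).mul hrw) .nil)
  exact this.of_le hd (by simpa using hU')

theorem represents_principal_five (hd : d ≠ 0) (hC : LiftsToPowers d squareResidues)
    {U V : Multiset GoldenInt} {v : GoldenInt} (hv : IsUnit v) (hU : ∀ u ∈ U, SameResidue u v)
    (hV : ∀ u ∈ V, IsUnit u) (hU5 : 5 ≤ U.card) (hV2 : 2 ≤ V.card) :
    Represents d (U + levelCoeffs 1 V) true 0 := by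
  obtain ⟨U', hU', hc⟩ := Multiset.exists_le_of_le_card hU5
  obtain ⟨V', hV', hc'⟩ := Multiset.exists_le_of_le_card hV2
  obtain ⟨w, hw⟩ := hv.exists_left_inv
  have hwu : IsUnit w := IsUnit.of_mul_eq_one _ hw
  have hrw : red w * red v = 1 := by rw [← map_mul, hw, map_one]
  have := represents_zero_of_search_mul hd hC search_principal_five hwu
    (Ms := [U', levelCoeffs 1 V'])
    (.cons (stage_special codes_principal hc
        fun u hu => (hU u (Multiset.mem_of_le hU' hu)).mul hrw)
      (.cons (stage_even (T := IsOdd) (fun q hq => by simpa using codes_double q hq) hc'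
        fun u hu => isOdd_red_mul hwu (hV u (Multiset.mem_of_le hV' hu))) .nil))
  refine this.of_le hd ?_
  simp only [List.sum_cons, List.sum_nil, add_zero]
  exact add_le_add hU' (levelCoeffs_le hV')

theorem represents_principal_seven (hd : d ≠ 0) (hC : LiftsToPowers d squareResidues)
    {U : Multiset GoldenInt} {v : GoldenInt} (hv : IsUnit v) (hU : ∀ u ∈ U, SameResidue u v)
    (hU7 : 7 ≤ U.card) : Represents d U true 0 := by
  obtain ⟨U', hU', hc⟩ := Multiset.exists_le_of_le_card hU7
  obtain ⟨w, hw⟩ := hv.exists_left_inv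
  have hrw : red w * red v = 1 := by rw [← map_mul, hw, map_one]
  have := represents_zero_of_search_mul hd hC search_principal_seven (IsUnit.of_mul_eq_one _ hw)
    (Ms := [U'])
    (.cons (stage_special codes_principal hc
        fun u hu => (hU u (Multiset.mem_of_le hU' hu)).mul hrw) .nil)
  exact this.of_le hd (by simpa using hU')

end SquareResidues

theorem GoldenInt.exists_eq_two_mul {z : GoldenInt} (h4 : 4 * red z = 0) (h2 : 2 * red z ≠ 0) :
    ∃ v, IsUnit v ∧ z = 2 * v := by
  have h : red (4 * z) = 0 := by rw [map_mul, map_ofNat, h4]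
  obtain ⟨v, hv⟩ := red_eq_zero_iff.1 h
  have hz : z = 2 * v := by
    have h40 : (4 : GoldenInt) ≠ 0 := by
      rw [← (map_ne_zero_iff toField toField_injective), map_ofNat]
      norm_num
    exact mul_left_cancel₀ h40 (by rw [hv]; ring)
  refine ⟨v, isUnit_iff_isOdd.2 fun h0 => h2 ?_, hz⟩
  rw [hz, map_mul, map_ofNat, ← h0]
  ring

theorem Represents.pair {d : ℕ} (a b : GoldenInt) : Represents d {a, b} true (a + b) := by
  simpa using (singleton_of_ne (d := d) a one_ne_zero).add (singleton_of_ne b one_ne_zero)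

/-- The three sums are even. If `4` divided all of them, it would divide `(a + b) + (a + c) - (b +
c) = 2a`. -/
theorem SameResidue.exists_pair {a b c : GoldenInt} (ha : IsUnit a) (hab : SameResidue a b)
    (hac : SameResidue a c) :
    ∃ v, IsUnit v ∧ (a + b = 2 * v ∨ a + c = 2 * v ∨ b + c = 2 * v) := by
  have h8 := eight_mul_red (red a)
  unfold SameResidue at hab hac
  by_cases h1 : 2 * red (a + b) = 0
  · by_cases h2 : 2 * red (a + c) = 0
    · obtain ⟨v, hv, h⟩ := exists_eq_two_mul (z := b + c)
        (by rw [map_add]; linear_combination h8 - hab - hac) (by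
          intro h3
          refine isUnit_iff_isOdd.1 ha ?_
          rw [map_add] at h1 h2 h3
          linear_combination h1 + h2 - h3)
      exact ⟨v, hv, Or.inr (Or.inr h)⟩
    · obtain ⟨v, hv, h⟩ := exists_eq_two_mul (z := a + c)
        (by rw [map_add]; linear_combination h8 - hac) h2
      exact ⟨v, hv, Or.inr (Or.inl h)⟩
  · obtain ⟨v, hv, h⟩ := exists_eq_two_mul (z := a + b)
      (by rw [map_add]; linear_combination h8 - hab) h1
    exact ⟨v, hv, Or.inl h⟩

theorem exists_pair_of_forall_eq {T : Multiset GoldenInt} (hT : ∀ u ∈ T, IsUnit u) {r : GoldenMod}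
    (hr : ∀ u ∈ T, 4 * red u = r) (h3 : 3 ≤ T.card) :
    ∃ a b v, {a, b} ≤ T ∧ IsUnit v ∧ a + b = 2 * v := by
  obtain ⟨T', hT', hc⟩ := Multiset.exists_le_of_le_card h3
  obtain ⟨a, b, c, rfl⟩ := Multiset.card_eq_three.1 hc
  have ha := Multiset.mem_of_le hT' (show a ∈ ({a, b, c} : Multiset GoldenInt) by simp)
  have hb := Multiset.mem_of_le hT' (show b ∈ ({a, b, c} : Multiset GoldenInt) by simp)
  have hc := Multiset.mem_of_le hT' (show c ∈ ({a, b, c} : Multiset GoldenInt) by simp)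
  obtain ⟨v, hv, h | h | h⟩ := SameResidue.exists_pair (hT a ha)
    ((hr a ha).trans (hr b hb).symm) ((hr a ha).trans (hr c hc).symm)
  · refine ⟨a, b, v, le_trans ?_ hT', hv, h⟩
    exact Multiset.cons_le_cons _ (Multiset.singleton_le.2 (by simp))
  · refine ⟨a, c, v, le_trans ?_ hT', hv, h⟩
    exact Multiset.cons_le_cons _ (Multiset.singleton_le.2 (by simp))
  · exact ⟨b, c, v, le_trans (Multiset.le_cons_self _ _) hT', hv, h⟩

theorem IsOdd.residue : ∀ q : GoldenMod, IsOdd q → 4 * q = 4 ∨ 4 * q = ⟨0, 4⟩ ∨ 4 * q = ⟨4, 4⟩ :=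
  forall_goldenMod (by decide +kernel)

/-- Pigeonhole: among seven units, three share one of the three nonzero residues in `F₄`. -/
theorem exists_pair_of_card {T : Multiset GoldenInt} (hT : ∀ u ∈ T, IsUnit u) (h7 : 7 ≤ T.card) :
    ∃ a b v, {a, b} ≤ T ∧ IsUnit v ∧ a + b = 2 * v := by
  have key : ∀ (p : GoldenInt → Prop) [DecidablePred p] (r : GoldenMod), (∀ u ∈ T, p u → 4 * red u = r) →
      3 ≤ (T.filter p).card → ∃ a b v, {a, b} ≤ T ∧ IsUnit v ∧ a + b = 2 * v := by
    intro p _ r hp hr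
    obtain ⟨a, b, v, h, h'⟩ := exists_pair_of_forall_eq (T := T.filter p) (r := r)
      (fun u hu => hT u (Multiset.mem_of_mem_filter hu))
      (fun u hu => hp u (Multiset.mem_of_mem_filter hu) (Multiset.mem_filter.1 hu).2) hr
    exact ⟨a, b, v, h.trans (Multiset.filter_le _ _), h'⟩
  by_contra hcon
  have h1 := mt (key (fun u => 4 * red u = 4) 4 fun _ _ => id) hcon
  have h2 := mt (key (fun u => 4 * red u = ⟨0, 4⟩ ∧ ¬ 4 * red u = 4) ⟨0, 4⟩ fun _ _ h => h.1) hcon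
  have h3 := mt (key (fun u => ¬ 4 * red u = ⟨0, 4⟩ ∧ ¬ 4 * red u = 4) ⟨4, 4⟩ fun u hu h =>
    ((IsOdd.residue _ (isUnit_iff_isOdd.1 (hT u hu))).resolve_left h.2).resolve_left h.1) hcon
  have h4 := congrArg Multiset.card (Multiset.filter_add_not (fun u => 4 * red u = 4) T)
  have h5 := congrArg Multiset.card (Multiset.filter_add_not (fun u => 4 * red u = ⟨0, 4⟩)
    (T.filter fun u => ¬ 4 * red u = 4))
  rw [Multiset.card_add] at h4 h5
  rw [Multiset.filter_filter, Multiset.filter_filter] at h5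
  omega

/-- From `a ≡ b` modulo `4` follows `a + b ≡ 2a` modulo `4`, so half the sum is congruent to `a`
modulo `2`. -/
theorem exists_half_of_eq {a b v : GoldenInt} (ha : IsUnit a) (hv : SameSign a v)
    (h : 2 * red a = 2 * red b) : ∃ w, IsUnit w ∧ SameResidue w v ∧ a + b = 2 * w := by
  have h8 := eight_mul_red (red a)
  have h2 : 2 * red (a + b) = 4 * red a := by rw [map_add]; linear_combination -h
  obtain ⟨w, hw, hab⟩ := exists_eq_two_mul (z := a + b) (by linear_combination 2 * h2 + h8)
    (by rw [h2]; exact isUnit_iff_isOdd.1 ha)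
  refine ⟨w, hw, ?_, hab⟩
  have h4 : 4 * red w = 4 * red a := by
    rw [← h2, hab, map_mul, map_ofNat]
    ring
  exact h4.trans hv.sameResidue

/-- Of three elements equal to `± v` modulo `4`, two agree modulo `4`. -/
theorem exists_half_of_sameSign {v x y : GoldenInt} (hv : IsUnit v) (hx : IsUnit x)
    (hxv : SameSign x v) (hyv : SameSign y v) :
    ∃ a b w, {a, b} ≤ ({v, x, y} : Multiset GoldenInt) ∧ IsUnit w ∧ SameResidue w v ∧
      a + b = 2 * w := by
  rcases hxv with h | h
  · obtain ⟨w, hw⟩ := exists_half_of_eq hv (Or.inl rfl) h.symm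
    exact ⟨v, x, w, Multiset.cons_le_cons _ (Multiset.singleton_le.2 (by simp)), hw⟩
  rcases hyv with h' | h'
  · obtain ⟨w, hw⟩ := exists_half_of_eq hv (Or.inl rfl) h'.symm
    exact ⟨v, y, w, Multiset.cons_le_cons _ (Multiset.singleton_le.2 (by simp)), hw⟩
  · obtain ⟨w, hw⟩ := exists_half_of_eq hx (Or.inr h) (h.trans h'.symm)
    exact ⟨x, y, w, Multiset.le_cons_self _ _, hw⟩

/-! ### Zeros from four consecutive levels. -/

section Levels

variable {d : ℕ}

/-- Replacing two coefficients `2 ^ k a`, `2 ^ k b` with `a + b = 2 v` by `2 ^ (k + 1) v`. -/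
theorem Represents.of_half (hd : d ≠ 0) {k : ℕ} {a b v : GoldenInt} (hab : a + b = 2 * v)
    {M : Multiset GoldenInt}
    (h : Represents d (levelCoeffs (k + 1) {v} + M) true 0) :
    Represents d (levelCoeffs k {a, b} + M) true 0 := by
  have h1 := (Represents.pair (d := d) a b).mul_left (2 ^ k)
  refine h1.contract hd ?_
  rw [levelCoeffs_singleton, Multiset.singleton_add] at h
  rwa [hab, ← mul_assoc, ← pow_succ]

/-- With seven units in `S₀`, one coefficient of level one suffices, obtained by contraction if `S₁`
is empty. Otherwise `S₁` has at least three elements. Two that differ modulo `4` beyond sign, or an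
element of `S₂` with another residue modulo `2`, give diversity enough for a zero. What remains is
rigid: `S₁` lies in `± v` modulo `4` and `S₂` in the class of `v` modulo `2`, and the higher levels
alone produce a zero. -/
theorem represents_of_levels (hd : d ≠ 0) (hC : LiftsToPowers d squareResidues)
    {S₀ S₁ S₂ S₃ : Multiset GoldenInt} (u₀ : ∀ u ∈ S₀, IsUnit u) (u₁ : ∀ u ∈ S₁, IsUnit u)
    (u₂ : ∀ u ∈ S₂, IsUnit u) (u₃ : ∀ u ∈ S₃, IsUnit u) (h₀ : 5 ≤ S₀.card)
    (h₁ : 9 ≤ S₀.card + S₁.card) (h₂ : 13 ≤ S₀.card + S₁.card + S₂.card)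
    (h₃ : 17 ≤ S₀.card + S₁.card + S₂.card + S₃.card) :
    Represents d (S₀ + levelCoeffs 1 S₁ + levelCoeffs 2 S₂ + levelCoeffs 3 S₃) true 0 := by
  rw [add_assoc, add_assoc]
  by_cases h7 : 7 ≤ S₀.card
  · rw [← add_assoc]
    by_cases hs : 1 ≤ S₁.card
    · exact (represents_seven hd hC u₀ u₁ h7 hs).of_le hd (Multiset.le_add_right _ _)
    · obtain ⟨a, b, v, hle, hv, hab⟩ := exists_pair_of_card u₀ h7
      obtain ⟨R, rfl⟩ := Multiset.le_iff_exists_add.1 hle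
      rw [Multiset.card_add, Multiset.card_pair] at h₁
      have := represents_seven hd hC (U := R) (V := {v})
        (fun u hu => u₀ u (Multiset.mem_add.2 (Or.inr hu))) (by simpa using hv) (by omega) (by simp)
      rw [add_comm] at this
      have := Represents.of_half hd (k := 0) hab this
      rw [levelCoeffs_zero] at this
      exact this.of_le hd ((Multiset.le_add_right _ _).trans (Multiset.le_add_right _ _))
  obtain ⟨U, hU, hUc⟩ := Multiset.exists_le_of_le_card h₀
  have uU : ∀ u ∈ U, IsUnit u := fun u hu => u₀ u (Multiset.mem_of_le hU hu)
  obtain ⟨v, T, rfl⟩ := Multiset.exists_cons_of_card_pos (s := S₁) (by omega)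
  have hv : IsUnit v := u₁ v (Multiset.mem_cons_self _ _)
  have uT : ∀ u ∈ T, IsUnit u := fun u hu => u₁ u (Multiset.mem_cons_of_mem hu)
  rw [Multiset.card_cons] at h₁ h₂ h₃
  by_cases hsign : ∀ x ∈ T, SameSign x v
  swap
  · push Not at hsign
    obtain ⟨x, hxT, hx⟩ := hsign
    obtain ⟨T', rfl⟩ := Multiset.exists_cons_of_mem hxT
    rw [Multiset.card_cons] at h₁
    obtain ⟨y, T', rfl⟩ := Multiset.exists_cons_of_card_pos (s := T') (by omega)
    refine (represents_distinct hd hC uU hUc hv (uT x (by simp)) (uT y (by simp)) hx).of_le hd ?_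
    refine add_le_add hU ((levelCoeffs_le ?_).trans (Multiset.le_add_right _ _))
    exact Multiset.cons_le_cons _ (Multiset.cons_le_cons _ (by simp))
  obtain ⟨x, T, rfl⟩ := Multiset.exists_cons_of_card_pos (s := T) (by omega)
  rw [Multiset.card_cons] at h₁ h₂ h₃
  obtain ⟨y, T, rfl⟩ := Multiset.exists_cons_of_card_pos (s := T) (by omega)
  rw [Multiset.card_cons] at h₁ h₂ h₃
  have hle : ({v, x, y} : Multiset GoldenInt) ≤ v ::ₘ x ::ₘ y ::ₘ T :=
    Multiset.cons_le_cons _ (Multiset.cons_le_cons _ (by simp))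
  have hx : SameSign x v := hsign x (by simp)
  have hy : SameSign y v := hsign y (by simp)
  by_cases hres : ∀ z ∈ S₂, SameResidue z v
  swap
  · push Not at hres
    obtain ⟨z, hz, hzv⟩ := hres
    refine (represents_quadruple hd hC uU hUc hv (u₂ z hz) hx hy hzv).of_le hd ?_
    rw [add_assoc]
    refine add_le_add hU (add_le_add (levelCoeffs_le hle) ?_)
    exact (levelCoeffs_le (Multiset.singleton_le.2 hz)).trans (Multiset.le_add_right _ _)
  have hsign' : ∀ u ∈ v ::ₘ x ::ₘ y ::ₘ T, SameSign u v := by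
    intro u hu
    rcases Multiset.mem_cons.1 hu with rfl | hu
    · exact Or.inl rfl
    · exact hsign u hu
  by_cases hT : 1 ≤ T.card
  · by_cases hz : S₂ = 0
    · subst hz
      rw [Multiset.card_zero] at h₂
      have := (represents_sign_five hd hC hv hsign' (by simp; omega)).shift 1
      exact this.of_le hd ((Multiset.le_add_right _ _).trans (Multiset.le_add_left _ _))
    · obtain ⟨z, hz⟩ := Multiset.exists_mem_of_ne_zero hz
      have := (represents_sign_four hd hC hv hsign' (by simp; omega) (hres z hz)).shift 1
      rw [Multiset.map_add, map_levelCoeffs] at this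
      refine this.of_le hd (le_trans ?_ (Multiset.le_add_left _ _))
      refine add_le_add le_rfl (le_trans (levelCoeffs_le ?_) (Multiset.le_add_right _ _))
      exact Multiset.singleton_le.2 hz
  -- Now `S₀` has six elements and `S₁` three, so `S₂` has at least four; the contracted `w` is a
  -- fifth element of the same residue.
  obtain ⟨a, b, w, hab, hw, hwv, hsum⟩ := exists_half_of_sameSign hv (uT x (by simp)) hx hy
  have hrep : Represents d ((w ::ₘ S₂) + levelCoeffs 1 S₃) true 0 := by
    have hprin : ∀ u ∈ w ::ₘ S₂, SameResidue u v := by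
      intro u hu
      rcases Multiset.mem_cons.1 hu with rfl | hu
      · exact hwv
      · exact hres u hu
    by_cases h6 : 6 ≤ S₂.card
    · exact (represents_principal_seven hd hC hv hprin (by simp; omega)).of_le hd
        (Multiset.le_add_right _ _)
    · exact represents_principal_five hd hC hv hprin u₃ (by simp; omega) (by omega)
  have := hrep.shift 2
  rw [Multiset.map_add, map_levelCoeffs, ← Multiset.singleton_add, Multiset.map_add,
    add_assoc] at this
  refine (Represents.of_half hd (k := 1) hsum this).of_le hd ?_
  exact (add_le_add (levelCoeffs_le (hab.trans hle)) le_rfl).trans (Multiset.le_add_left _ _)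

theorem represents_three_units (hd : d ≠ 0) (hC : LiftsToPowers d squareResidues₃)
    {S₀ S₁ S₂ : Multiset GoldenInt} (u₀ : ∀ u ∈ S₀, IsUnit u) (u₁ : ∀ u ∈ S₁, IsUnit u)
    (u₂ : ∀ u ∈ S₂, IsUnit u) (h₀ : 3 ≤ S₀.card) (h₁ : 4 ≤ S₀.card + S₁.card)
    (h₂ : 5 ≤ S₀.card + S₁.card + S₂.card) :
    Represents d (S₀ + levelCoeffs 1 S₁ + levelCoeffs 2 S₂) true 0 := by
  have unit {n : ℕ} {U : Multiset GoldenInt} (hU : U ≤ S₀) (hn : U.card = n) :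
      U.card = n ∧ ∀ p ∈ U, true = decide (IsOdd (red p)) ∧
        ∃ ks ∈ unitCodes₃, Codes squareResidues₃ ks (red p) := by
    simpa using stage_unit codes_unit₃ hn (fun u hu => u₀ u (Multiset.mem_of_le hU hu)) isUnit_one
  rcases Nat.eq_zero_or_pos S₁.card with hs | hs
  · rcases Nat.eq_zero_or_pos S₂.card with hs' | hs'
    · obtain ⟨U, hU, hc⟩ := Multiset.exists_le_of_le_card (show 5 ≤ S₀.card by omega)
      have := represents_zero_of_search hd hC search₃_five (Ms := [U])
        (.cons (unit hU hc) .nil)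
      simp only [List.sum_cons, List.sum_nil, add_zero] at this
      refine this.of_le hd (hU.trans ?_)
      rw [add_assoc]
      exact Multiset.le_add_right _ _
    · obtain ⟨U, hU, hc⟩ := Multiset.exists_le_of_le_card (show 4 ≤ S₀.card by omega)
      obtain ⟨z, S, rfl⟩ := Multiset.exists_cons_of_card_pos hs'
      have := represents_zero_of_search hd hC search₃_four' (Ms := [levelCoeffs 2 {z}, U])
        (.cons (by
          simpa only [map_one, one_mul] using stage_even (w := 1) (k := 2) (T := IsOdd)
            (fun q hq => by rw [show (2 : GoldenMod) ^ 2 = 4 by norm_num]; exact codes_quadruple₃ q hq)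
            (Multiset.card_singleton z) (by simpa using isUnit_iff_isOdd.1 (u₂ z (by simp))))
          (.cons (unit hU hc) .nil))
      simp only [List.sum_cons, List.sum_nil, add_zero] at this
      refine this.of_le hd ?_
      rw [add_comm, add_right_comm]
      exact (add_le_add hU (levelCoeffs_le (by simp))).trans (Multiset.le_add_right _ _)
  · obtain ⟨U, hU, hc⟩ := Multiset.exists_le_of_le_card h₀
    obtain ⟨z, S, rfl⟩ := Multiset.exists_cons_of_card_pos hs
    have := represents_zero_of_search hd hC search₃_three (Ms := [levelCoeffs 1 {z}, U])
      (.cons (by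
        simpa only [map_one, one_mul] using stage_even (w := 1) (k := 1) (T := IsOdd)
          (fun q hq => by simpa using codes_double₃ q hq)
          (Multiset.card_singleton z) (by simpa using isUnit_iff_isOdd.1 (u₁ z (by simp))))
        (.cons (unit hU hc) .nil))
    simp only [List.sum_cons, List.sum_nil, add_zero] at this
    refine this.of_le hd ?_
    rw [add_comm]
    exact (add_le_add hU (levelCoeffs_le (by simp))).trans (Multiset.le_add_right _ _)

theorem codes_one₃ : ∃ ks ∈ [[16, 17, 35, 39, 80, 85]], Codes squareResidues₃ ks 1 := by
  decide +kernel

/-- If a value `a + b c`, with `c` a `d`-th power, is twice a unit, it joins `S₁`, and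
`represents_three_units` applies one level higher. If not, `codes_bad₃` restricts `b / a` to two
classes, few enough for a search. -/
theorem represents_two_units (hd : d ≠ 0) (hC : LiftsToPowers d squareResidues₃)
    {a b : GoldenInt} (ha : IsUnit a) (hb : IsUnit b)
    {S₁ S₂ S₃ : Multiset GoldenInt} (u₁ : ∀ u ∈ S₁, IsUnit u)
    (u₂ : ∀ u ∈ S₂, IsUnit u) (u₃ : ∀ u ∈ S₃, IsUnit u)
    (h₁ : 2 ≤ S₁.card) (h₂ : 3 ≤ S₁.card + S₂.card) (h₃ : 4 ≤ S₁.card + S₂.card + S₃.card) :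
    Represents d ({a, b} + levelCoeffs 1 S₁ + levelCoeffs 2 S₂ + levelCoeffs 3 S₃) true 0 := by
  obtain ⟨w, hw⟩ := ha.exists_left_inv
  have hwu : IsUnit w := IsUnit.of_mul_eq_one _ hw
  have hrw : red w * red a = 1 := by rw [← map_mul, hw, map_one]
  by_cases hgood : ∃ c ∈ squareResidues₃,
      4 * (1 + c * (red w * red b)) = 0 ∧ 2 * (1 + c * (red w * red b)) ≠ 0
  · obtain ⟨c, hc, hc4, hc2⟩ := hgood
    obtain ⟨c, rfl⟩ := red_surjective c
    obtain ⟨x, hx0, hx⟩ := hC.exists_ne_zero hd hc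
    obtain ⟨v, hv, hz⟩ := exists_eq_two_mul (z := a + b * c)
      (by
        rw [map_add, map_mul]
        linear_combination red a * hc4 - 4 * red b * red c * hrw)
      (fun h => hc2 (by
        rw [map_add, map_mul] at h
        linear_combination red w * h - 2 * hrw))
    have hN : Represents d ({a} + {b}) true (2 * v) := by
      have := (Represents.singleton_of_ne (d := d) a one_ne_zero).add
        (Represents.singleton_of_ne (d := d) b hx0)
      rwa [one_pow, mul_one, hx, hz] at this
    have := (represents_three_units hd hC (S₀ := v ::ₘ S₁) (by simpa using ⟨hv, u₁⟩) u₂ u₃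
      (by simp; omega) (by simp; omega) (by simp; omega)).shift 1
    rw [Multiset.map_add, Multiset.map_add, map_levelCoeffs, map_levelCoeffs, Multiset.map_cons,
      pow_one, Multiset.cons_add, Multiset.cons_add] at this
    refine (hN.contract hd this).of_le hd (le_of_eq ?_)
    simp only [Multiset.insert_eq_cons, ← Multiset.singleton_add, add_assoc, levelCoeffs, pow_one]
  · push Not at hgood
    have hbad := codes_bad₃ (red w * red b) (isOdd_red_mul hwu hb)
      fun c hc h => h.2 (hgood c hc h.1)
    have first : ({a} : Multiset GoldenInt).card = 1 ∧ ∀ p ∈ ({a} : Multiset GoldenInt),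
        true = decide (IsOdd (red w * red p)) ∧
        ∃ ks ∈ [[16, 17, 35, 39, 80, 85]], Codes squareResidues₃ ks (red w * red p) := by
      refine ⟨rfl, fun p hp => ?_⟩
      obtain rfl := Multiset.mem_singleton.1 hp
      exact ⟨by simpa using isOdd_red_mul hwu ha, by rw [hrw]; exact codes_one₃⟩
    have second : ({b} : Multiset GoldenInt).card = 1 ∧ ∀ p ∈ ({b} : Multiset GoldenInt),
        true = decide (IsOdd (red w * red p)) ∧
        ∃ ks ∈ [[33, 37, 52, 55, 115, 116], [48, 51, 97, 101, 112, 119]],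
          Codes squareResidues₃ ks (red w * red p) := by
      refine ⟨rfl, fun p hp => ?_⟩
      obtain rfl := Multiset.mem_singleton.1 hp
      exact ⟨by simpa using isOdd_red_mul hwu hb, hbad⟩
    have double {n : ℕ} {U : Multiset GoldenInt} (hU : U ≤ S₁) (hn : U.card = n) :=
      stage_even (k := 1) (T := IsOdd) (fun q hq => by simpa using codes_double₃ q hq) hn
        fun u hu => isOdd_red_mul hwu (u₁ u (Multiset.mem_of_le hU hu))
    by_cases h3 : 3 ≤ S₁.card
    · obtain ⟨U, hU, hc⟩ := Multiset.exists_le_of_le_card h3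
      have := represents_zero_of_search_mul hd hC search₃_two hwu
        (Ms := [{a}, {b}, levelCoeffs 1 U])
        (.cons first (.cons second (.cons (double hU hc) .nil)))
      simp only [List.sum_cons, List.sum_nil, add_zero, ← add_assoc] at this
      refine this.of_le hd ?_
      exact ((add_le_add le_rfl (levelCoeffs_le hU)).trans (Multiset.le_add_right _ _)).trans
        (Multiset.le_add_right _ _)
    · obtain ⟨z, S, rfl⟩ := Multiset.exists_cons_of_card_pos (s := S₂) (by omega)
      have := represents_zero_of_search_mul hd hC search₃_two' hwu
        (Ms := [{a}, {b}, levelCoeffs 1 S₁, levelCoeffs 2 {z}])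
        (.cons first (.cons second (.cons (double le_rfl (show S₁.card = 2 by omega)) (.cons
          (stage_even (k := 2) (T := IsOdd)
            (fun q hq => by
              rw [show (2 : GoldenMod) ^ 2 = 4 by norm_num]
              exact codes_quadruple₃ q hq)
            (Multiset.card_singleton z) (by simpa using isOdd_red_mul hwu (u₂ z (by simp))))
          .nil))))
      simp only [List.sum_cons, List.sum_nil, add_zero] at this
      refine this.of_le hd ?_
      rw [← add_assoc, ← add_assoc]
      refine le_trans ?_ (Multiset.le_add_right _ _)
      exact add_le_add le_rfl (levelCoeffs_le (by simp))

theorem represents_of_levels₃ (hd : d ≠ 0) (hC : LiftsToPowers d squareResidues₃)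
    {S₀ S₁ S₂ S₃ : Multiset GoldenInt} (u₀ : ∀ u ∈ S₀, IsUnit u) (u₁ : ∀ u ∈ S₁, IsUnit u)
    (u₂ : ∀ u ∈ S₂, IsUnit u) (u₃ : ∀ u ∈ S₃, IsUnit u) (h₀ : 2 ≤ S₀.card)
    (h₁ : 4 ≤ S₀.card + S₁.card) (h₂ : 5 ≤ S₀.card + S₁.card + S₂.card)
    (h₃ : 7 ≤ S₀.card + S₁.card + S₂.card + S₃.card) :
    Represents d (S₀ + levelCoeffs 1 S₁ + levelCoeffs 2 S₂ + levelCoeffs 3 S₃) true 0 := by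
  by_cases h3 : 3 ≤ S₀.card
  · exact (represents_three_units hd hC u₀ u₁ u₂ h3 h₁ h₂).of_le hd (Multiset.le_add_right _ _)
  · obtain ⟨a, b, rfl⟩ := Multiset.card_eq_two.1 (show S₀.card = 2 by omega)
    rw [Multiset.card_pair] at h₁ h₂ h₃
    exact represents_two_units hd hC (u₀ a (by simp)) (u₀ b (by simp)) u₁ u₂ u₃ (by omega)
      (by omega) (by omega)

end Levels

/-! ### Available powers, cyclic normalization and the upper bounds. -/

theorem liftsToPowers_squareResidues {m : ℕ} (hm : Odd m) :
    LiftsToPowers (2 * m) squareResidues :=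
  ⟨by decide +kernel, fun u hu => exists_pow_eq hm (by simpa [squareResidues] using hu)⟩

theorem liftsToPowers_squareResidues₃ {m : ℕ} (hm : Odd m) (h3 : ¬ 3 ∣ m) :
    LiftsToPowers (2 * m) squareResidues₃ := by
  refine ⟨by decide +kernel, fun u hu => ?_⟩
  obtain ⟨φ, hφ⟩ := red_surjective ⟨0, 1⟩
  have hunit : IsUnit φ := by rw [isUnit_iff_isOdd, hφ]; decide +kernel
  obtain ⟨ψ, hψ⟩ := hunit.exists_left_inv
  -- Modulo `8`, `φ` has `φ ^ 12 = 1`, and `2 * m` is `2` or `10` modulo `12`. Either power,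
  -- multiplied in repeatedly, brings each class of `squareResidues₃` to `1` or `5`.
  have hpow : red φ ^ (2 * m) = ⟨1, 1⟩ ∨ red φ ^ (2 * m) = ⟨2, 7⟩ := by
    rw [hφ]
    have h12 : (⟨0, 1⟩ : GoldenMod) ^ 12 = 1 := by decide +kernel
    have hm6 : m = 6 * (m / 6) + 1 ∨ m = 6 * (m / 6) + 5 := by
      obtain ⟨k, hk⟩ := hm
      omega
    rcases hm6 with h | h
    · rw [h, show 2 * (6 * (m / 6) + 1) = 12 * (m / 6) + 2 by ring, pow_add, pow_mul, h12, one_pow]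
      decide +kernel
    · rw [h, show 2 * (6 * (m / 6) + 5) = 12 * (m / 6) + 10 by ring, pow_add, pow_mul, h12, one_pow]
      decide +kernel
  have hj : ∀ p : GoldenMod, (p = ⟨1, 1⟩ ∨ p = ⟨2, 7⟩) → ∀ c ∈ squareResidues₃,
      ∃ j < 3, c * p ^ j = 1 ∨ c * p ^ j = 5 := by
    rintro p (rfl | rfl)
    · decide +kernel
    · decide +kernel
  obtain ⟨j, -, hj⟩ := hj _ hpow _ hu
  obtain ⟨w, hw⟩ := exists_pow_eq hm (u := u * (φ ^ (2 * m)) ^ j) (by simpa using hj)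
  refine ⟨w * ψ ^ j, ?_⟩
  rw [mul_pow, hw, ← pow_mul, ← pow_mul, mul_comm (2 * m) j, mul_assoc, ← mul_pow, mul_comm φ, hψ,
    one_pow, mul_one]

/-- A cycle lemma: the excess `f` of the partial sums over their average growth has period `d`, and
`j` is a place where it is least. -/
theorem exists_forall_mul_le_sum {d : ℕ} (hd : 0 < d) {N : ℕ → ℕ} (hN : ∀ k, N (k + d) = N k) :
    ∃ j, ∀ t, (∑ k ∈ Finset.range d, N k) * t ≤ d * ∑ l ∈ Finset.range t, N (j + l) := by
  set s := ∑ k ∈ Finset.range d, N k with hs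
  let f : ℕ → ℤ := fun j => d * ∑ l ∈ Finset.range j, (N l : ℤ) - s * j
  have hf : ∀ j, f (j + d) = f j := by
    intro j
    induction j with
    | zero => simp [f, hs, mul_comm]
    | succ j ih =>
      have h1 : ∀ i, f (i + 1) = f i + (d * N i - s) := by
        intro i
        simp only [f, Finset.sum_range_succ]
        push_cast
        ring
      rw [show j + 1 + d = j + d + 1 by ring, h1, h1, ih, hN]
  have hf' : ∀ i, f i = f (i % d) := by
    intro i
    exact ((show Function.Periodic f d from hf).map_mod_nat i).symm
  obtain ⟨j, -, hj⟩ := Finset.exists_min_image (Finset.range d) f ⟨0, Finset.mem_range.2 hd⟩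
  refine ⟨j, fun t => ?_⟩
  have h := hj ((j + t) % d) (Finset.mem_range.2 (Nat.mod_lt _ hd))
  rw [← hf'] at h
  simp only [f, Finset.sum_range_add] at h
  zify
  push_cast at h
  linarith

theorem exists_levels {d s : ℕ} (hd : 0 < d) (n : Fin s → ℤ) :
    ∃ (j : ℕ) (l : Fin s → ℕ) (q : Fin s → ℤ), (∀ i, n i = j + l i + d * q i) ∧
      ∀ t ≤ d, s * t ≤ d * ∑ k ∈ Finset.range t, (Finset.univ.filter fun i => l i = k).card := by
  have hd' : (0 : ℤ) < d := by exact_mod_cast hd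
  let level (j : ℕ) (i : Fin s) : ℕ := ((n i - j) % d).toNat
  have hlevel : ∀ j i, (level j i : ℤ) = (n i - j) % d :=
    fun j i => Int.toNat_of_nonneg (Int.emod_nonneg _ hd'.ne')
  let N (k : ℕ) : ℕ := (Finset.univ.filter fun i => (d : ℤ) ∣ n i - k).card
  have hNl : ∀ j k, k < d → N (j + k) = (Finset.univ.filter fun i => level j i = k).card := by
    intro j k hk
    refine congrArg Finset.card (Finset.filter_congr fun i _ => ?_)
    have hk' : (k : ℤ) < d := by exact_mod_cast hk
    rw [← Nat.cast_inj (R := ℤ), hlevel]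
    push_cast
    rw [← sub_sub]
    refine ⟨?_, fun h => Int.dvd_self_sub_of_emod_eq h⟩
    rintro ⟨c, hc⟩
    rw [eq_add_of_sub_eq' hc, Int.add_mul_emod_self_left, Int.emod_eq_of_lt (by omega) hk']
  have hN : ∀ k, N (k + d) = N k := by
    intro k
    refine congrArg Finset.card (Finset.filter_congr fun i _ => ?_)
    push_cast
    rw [← sub_sub]
    exact dvd_sub_self_right
  have hs : ∑ k ∈ Finset.range d, N k = s := by
    have h := Finset.card_eq_sum_card_fiberwise (s := (Finset.univ : Finset (Fin s)))
      (t := Finset.range d) (f := level 0) (fun i _ => by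
        have h1 := Int.emod_lt_of_pos (n i - (0 : ℕ)) hd'
        rw [← hlevel] at h1
        simpa using h1)
    rw [Finset.card_univ, Fintype.card_fin] at h
    refine Eq.trans (Finset.sum_congr rfl fun k hk => ?_) h.symm
    have := hNl 0 k (Finset.mem_range.1 hk)
    rwa [zero_add] at this
  obtain ⟨j, hj⟩ := exists_forall_mul_le_sum hd hN
  refine ⟨j, level j, fun i => (n i - j) / d, fun i => ?_, fun t ht => ?_⟩
  · rw [hlevel]
    have := Int.emod_add_mul_ediv (n i - j) d
    linarith
  · have h := hj t
    rw [hs] at h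
    refine h.trans (le_of_eq (congrArg _ (Finset.sum_congr rfl fun k hk => ?_)))
    exact hNl j k ((Finset.mem_range.1 hk).trans_le ht)

theorem Multiset.exists_eq_map_of_map_fst_eq {ι A : Type*} {I : Multiset ι} (hI : I.Nodup)
    {g : ι → A} {X : Multiset (A × A)} (h : X.map Prod.fst = I.map g) :
    ∃ x : ι → A, X = I.map fun i => (g i, x i) := by
  classical
  induction I using Multiset.induction_on generalizing X with
  | empty => exact ⟨g, by simpa using h⟩
  | cons i I ih =>
    rw [Multiset.map_cons] at h
    obtain ⟨p, hp, hpg, hX⟩ := (Multiset.map_eq_cons Prod.fst X _ _).2 h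
    obtain ⟨hi, hI⟩ := Multiset.nodup_cons.1 hI
    obtain ⟨x, hx⟩ := ih hI hX
    refine ⟨Function.update x i p.2, ?_⟩
    rw [Multiset.map_cons, Function.update_self, ← hpg, ← Multiset.cons_erase hp, hx]
    refine congrArg _ (Multiset.map_congr rfl fun k hk => ?_)
    rw [Function.update_of_ne (by rintro rfl; exact hi hk)]

theorem Represents.exists_sum_eq_zero {A : Type*} [CommRing A] {d s : ℕ} {g : Fin s → A}
    (h : Represents d ((Finset.univ : Finset (Fin s)).val.map g) true 0) :
    ∃ x : Fin s → A, x ≠ 0 ∧ ∑ i, g i * x i ^ d = 0 := by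
  obtain ⟨X, h1, h2, h3⟩ := h
  obtain ⟨x, rfl⟩ := Multiset.exists_eq_map_of_map_fst_eq Finset.univ.nodup h1
  refine ⟨x, ?_, ?_⟩
  · rintro rfl
    obtain ⟨p, hp, hp0⟩ := h2 rfl
    obtain ⟨i, -, rfl⟩ := Multiset.mem_map.1 hp
    exact hp0 rfl
  · rwa [Multiset.map_map] at h3

theorem hasNontrivialZero_of_represents {d s : ℕ} (hd : d ≠ 0) {a : Fin s → Q2Sqrt5}
    {b : Fin s → GoldenInt} {c : Q2Sqrt5} {z : Fin s → Q2Sqrt5} (hz : ∀ i, z i ≠ 0)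
    (ha : ∀ i, a i = c * toField (b i) * z i ^ d) {I : Multiset (Fin s)}
    (hI : I ≤ (Finset.univ : Finset (Fin s)).val) (h : Represents d (I.map b) true 0) :
    HasNontrivialZero d a := by
  have h1 := (h.of_le hd (Multiset.map_le_map hI)).map toField_injective
  rw [Multiset.map_map, map_zero] at h1
  obtain ⟨x, hx, hsum⟩ := h1.exists_sum_eq_zero
  refine ⟨fun i => x i / z i, fun h0 => hx ?_, ?_⟩
  · funext i
    have := congrFun h0 i
    simpa [hz i] using this
  · have : ∀ i, a i * (x i / z i) ^ d = c * (toField (b i) * x i ^ d) := by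
      intro i
      have := pow_ne_zero d (hz i)
      rw [ha, div_pow]
      field_simp
    simp only [this, ← Finset.mul_sum]
    simp only [Function.comp_apply] at hsum
    rw [hsum, mul_zero]

/-- A form has a nontrivial zero as soon as forms with the coefficients from four consecutive levels
do, for all numbers of coefficients allowed by a cyclic shift of the levels. -/
theorem hasNontrivialZero_of_levels {d s : ℕ} (hd : 4 ≤ d)
    (H : ∀ S₀ S₁ S₂ S₃ : Multiset GoldenInt, (∀ u ∈ S₀, IsUnit u) → (∀ u ∈ S₁, IsUnit u) →
      (∀ u ∈ S₂, IsUnit u) → (∀ u ∈ S₃, IsUnit u) → s * 1 ≤ d * S₀.card →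
      s * 2 ≤ d * (S₀.card + S₁.card) → s * 3 ≤ d * (S₀.card + S₁.card + S₂.card) →
      s * 4 ≤ d * (S₀.card + S₁.card + S₂.card + S₃.card) →
      Represents d (S₀ + levelCoeffs 1 S₁ + levelCoeffs 2 S₂ + levelCoeffs 3 S₃) true 0)
    (a : Fin s → Q2Sqrt5) : HasNontrivialZero d a := by
  have hd0 : d ≠ 0 := by omega
  by_cases h0 : ∃ i, a i = 0
  · obtain ⟨i, hi⟩ := h0
    refine ⟨Pi.single i 1, by simp, Finset.sum_eq_zero fun k _ => ?_⟩
    by_cases hk : k = i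
    · rw [hk, hi, zero_mul]
    · rw [Pi.single_eq_of_ne hk, zero_pow hd0, mul_zero]
  push Not at h0
  choose n u hu ha using fun i => exists_zpow_mul (h0 i)
  obtain ⟨j, l, q, hn, hl⟩ := exists_levels (show 0 < d by omega) n
  have h2 : (2 : Q2Sqrt5) ≠ 0 := by norm_num
  let F (k : ℕ) : Multiset (Fin s) := (Finset.univ.filter fun i => l i = k).val
  let S (k : ℕ) : Multiset GoldenInt := (F k).map u
  have hS : ∀ k, ∀ v ∈ S k, IsUnit v := by
    intro k v hv
    obtain ⟨i, -, rfl⟩ := Multiset.mem_map.1 hv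
    exact hu i
  have hcard : ∀ k, (S k).card = (Finset.univ.filter fun i => l i = k).card :=
    fun k => Multiset.card_map _ _
  have hrep := H (S 0) (S 1) (S 2) (S 3) (hS 0) (hS 1) (hS 2) (hS 3)
    (by simpa [Finset.sum_range_succ, hcard] using hl 1 (by omega))
    (by simpa [Finset.sum_range_succ, hcard] using hl 2 (by omega))
    (by simpa [Finset.sum_range_succ, hcard] using hl 3 (by omega))
    (by simpa [Finset.sum_range_succ, hcard] using hl 4 (by omega))
  refine hasNontrivialZero_of_represents hd0 (b := fun i => 2 ^ l i * u i) (c := 2 ^ j)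
    (z := fun i => 2 ^ q i) (fun i => zpow_ne_zero _ h2) (fun i => ?_)
    (I := F 0 + F 1 + F 2 + F 3) ?_ ?_
  · rw [ha, hn, map_mul, map_pow, map_ofNat, zpow_add₀ h2, zpow_add₀ h2, zpow_natCast, zpow_natCast,
      mul_comm (d : ℤ), zpow_mul, zpow_natCast]
    ring
  · rw [Multiset.le_iff_count]
    intro i
    simp only [Multiset.count_add, F, Finset.filter_val, Multiset.count_filter]
    split_ifs <;> omega
  · have hlevel : ∀ k, (F k).map (fun i => 2 ^ l i * u i) = levelCoeffs k (S k) := by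
      intro k
      rw [levelCoeffs, Multiset.map_map]
      refine Multiset.map_congr rfl fun i hi => ?_
      have hik : l i = k := by simpa [F] using hi
      rw [Function.comp_apply, hik]
    rwa [Multiset.map_add, Multiset.map_add, Multiset.map_add, hlevel, hlevel, hlevel, hlevel,
      levelCoeffs_zero]

theorem hasNontrivialZero_of_lt {m s : ℕ} (hm : Odd m) (hm3 : 3 ≤ m) (hs : 4 * (2 * m) < s)
    (a : Fin s → Q2Sqrt5) : HasNontrivialZero (2 * m) a := by
  refine hasNontrivialZero_of_levels (by omega) ?_ a
  intro S₀ S₁ S₂ S₃ u₀ u₁ u₂ u₃ h₀ h₁ h₂ h₃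
  -- Strictness gives the cumulative counts `5, 9, 13, 17`.
  have key : ∀ t x, 0 < t → s * t ≤ 2 * m * x → 4 * t < x := by
    intro t x ht h
    refine Nat.lt_of_mul_lt_mul_left (a := 2 * m) (lt_of_lt_of_le ?_ h)
    calc 2 * m * (4 * t) = 4 * (2 * m) * t := by ring
      _ < s * t := Nat.mul_lt_mul_of_pos_right hs ht
  exact represents_of_levels (by omega) (liftsToPowers_squareResidues hm) u₀ u₁ u₂ u₃
    (key 1 _ one_pos h₀) (key 2 _ two_pos h₁) (key 3 _ three_pos h₂) (key 4 _ four_pos h₃)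

theorem hasNontrivialZero_of_lt_of_not_dvd {m s : ℕ} (hm : Odd m) (hm3 : 3 ≤ m) (h3 : ¬ 3 ∣ m)
    (hs : 3 * m < s) (a : Fin s → Q2Sqrt5) : HasNontrivialZero (2 * m) a := by
  refine hasNontrivialZero_of_levels (by omega) ?_ a
  intro S₀ S₁ S₂ S₃ u₀ u₁ u₂ u₃ h₀ h₁ h₂ h₃
  -- By integrality the cumulative counts are at least `2, 4, 5, 7`.
  have key : ∀ t x, 0 < t → s * t ≤ 2 * m * x → 3 * t < 2 * x := by
    intro t x ht h
    refine Nat.lt_of_mul_lt_mul_left (a := m) (lt_of_lt_of_le ?_ (h.trans (le_of_eq ?_)))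
    · calc m * (3 * t) = 3 * m * t := by ring
        _ < s * t := Nat.mul_lt_mul_of_pos_right hs ht
    · ring
  have k₀ := key 1 _ one_pos h₀
  have k₁ := key 2 _ two_pos h₁
  have k₂ := key 3 _ three_pos h₂
  have k₃ := key 4 _ four_pos h₃
  exact represents_of_levels₃ (by omega) (liftsToPowers_squareResidues₃ hm h3) u₀ u₁ u₂ u₃
    (by omega) (by omega) (by omega) (by omega)

/-! ### Lower bounds from anisotropic forms, and the conclusion. -/

theorem add_one_le_gammaStar {K : Type*} [Field K] {d s : ℕ} {a : Fin s → K}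
    (ha : ¬ HasNontrivialZero d a) : ((s + 1 : ℕ) : ℕ∞) ≤ gammaStar d K := by
  refine le_sInf ?_
  rintro _ ⟨N, rfl, hN⟩
  rw [Nat.cast_le]
  by_contra h
  exact ha (hN s (by omega) a)

theorem gammaStar_le {K : Type*} [Field K] {d s : ℕ}
    (h : ∀ t, s < t → ∀ a : Fin t → K, HasNontrivialZero d a) :
    gammaStar d K ≤ ((s + 1 : ℕ) : ℕ∞) :=
  sInf_le ⟨s + 1, rfl, fun t ht => h t ht⟩

/-- Factor out the least power of `4` among the nonzero terms and reduce modulo `4`. The factor `2`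
in `hT` and in `t` expresses congruence modulo `4` inside `O / 8`. -/
theorem not_sum_eq_zero {m r : ℕ} {c : Fin r → GoldenInt} {T : List GoldenMod}
    (hT : ∀ q, IsOdd q → 2 * q ^ (2 * m) ∈ T) (h0 : 0 ∉ T)
    (hc : ∀ t : Fin r → GoldenMod, (∀ i, t i ∈ 0 :: T) → ∑ i, red (c i) * t i = 0 → ∀ i, t i = 0)
    {x : Fin m × Fin r → Q2Sqrt5} (hx : x ≠ 0) :
    ∑ p, (2 ^ (2 * (p.1 : ℕ)) * toField (c p.2)) * x p ^ (2 * m) ≠ 0 := by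
  classical
  intro hsum
  have h2 : (2 : Q2Sqrt5) ≠ 0 := by norm_num
  have hm : m ≠ 0 := by
    rintro rfl
    exact hx (funext fun p => p.1.elim0)
  have hd : 2 * m ≠ 0 := by omega
  have hex : ∀ p, ∃ (k : ℤ) (y : GoldenInt), x p ≠ 0 → IsUnit y ∧ x p = 2 ^ k * toField y := by
    intro p
    by_cases hp : x p = 0
    · exact ⟨0, 0, fun h => absurd hp h⟩
    · obtain ⟨k, y, h⟩ := exists_zpow_mul hp
      exact ⟨k, y, fun _ => h⟩
  choose k y hky using hex
  -- When `c p.2` is a unit, this is half the valuation of the term; it determines the block `p.1 <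
  -- m` modulo `m`.
  let e (p : Fin m × Fin r) : ℤ := p.1 + m * k p
  obtain ⟨p₁, hp₁⟩ := Function.ne_iff.1 hx
  obtain ⟨p₀, hp₀, hmin⟩ := Finset.exists_min_image (Finset.univ.filter fun p => x p ≠ 0) e
    ⟨p₁, by simpa using hp₁⟩
  simp only [Finset.mem_filter, Finset.mem_univ, true_and] at hp₀ hmin
  let b (p : Fin m × Fin r) : GoldenInt :=
    if x p = 0 then 0 else 4 ^ (e p - e p₀).toNat * (c p.2 * y p ^ (2 * m))
  have hb : ∀ p, (2 ^ (2 * (p.1 : ℕ)) * toField (c p.2)) * x p ^ (2 * m) =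
      (4 : Q2Sqrt5) ^ e p₀ * toField (b p) := by
    intro p
    by_cases hp : x p = 0
    · simp [b, hp, zero_pow hd]
    · have h4 : (4 : Q2Sqrt5) = 2 ^ (2 : ℤ) := by norm_num
      have h5 : (4 : Q2Sqrt5) ^ (e p - e p₀).toNat = 4 ^ (e p - e p₀) := by
        rw [← zpow_natCast, Int.toNat_of_nonneg (sub_nonneg.2 (hmin p hp))]
      simp only [b, if_neg hp, map_mul, map_pow, map_ofNat]
      rw [h5, ← mul_assoc, ← zpow_add₀ (by norm_num : (4 : Q2Sqrt5) ≠ 0), add_sub_cancel]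
      conv_lhs => rw [(hky p hp).2]
      simp only [e]
      rw [h4, ← zpow_mul, mul_pow, ← zpow_natCast (2 ^ k p), ← zpow_mul, ← zpow_natCast, mul_add,
        zpow_add₀ h2]
      push_cast
      rw [show (2 : ℤ) * (m * k p) = k p * (2 * m) by ring]
      ring
  have hzero : ∑ p, b p = 0 := by
    simp only [hb, ← Finset.mul_sum, ← map_sum] at hsum
    rcases mul_eq_zero.1 hsum with h | h
    · exact absurd h (zpow_ne_zero _ (by norm_num))
    · exact (map_eq_zero_iff _ toField_injective).1 h
  have heq : ∀ p, e p = e p₀ → p.1 = p₀.1 := by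
    intro p hp
    have h1 : ((p.1 : ℕ) : ℤ) ≡ ((p₀.1 : ℕ) : ℤ) [ZMOD m] := by
      refine (Int.modEq_iff_dvd).2 ⟨k p - k p₀, ?_⟩
      simp only [e] at hp
      linarith
    have h2 := Int.natCast_modEq_iff.1 h1
    rw [Nat.ModEq, Nat.mod_eq_of_lt p.1.2, Nat.mod_eq_of_lt p₀.1.2] at h2
    exact Fin.ext h2
  let t (p : Fin m × Fin r) : GoldenMod :=
    if x p ≠ 0 ∧ e p = e p₀ then 2 * red (y p) ^ (2 * m) else 0
  have ht : ∀ p, 2 * red (b p) = red (c p.2) * t p := by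
    intro p
    by_cases hp : x p = 0
    · simp [b, t, hp]
    by_cases hep : e p = e p₀
    · simp only [b, t, if_neg hp, hep, if_pos (And.intro hp hep), sub_self, Int.toNat_zero, pow_zero,
        one_mul, map_mul, map_pow]
      ring
    · have h1 : (e p - e p₀).toNat ≠ 0 := by
        have := hmin p hp
        omega
      obtain ⟨n, hn⟩ := Nat.exists_eq_succ_of_ne_zero h1
      simp only [b, t, if_neg hp, if_neg fun h : x p ≠ 0 ∧ e p = e p₀ => hep h.2, mul_zero, hn,
        Nat.succ_eq_add_one, pow_succ, map_mul, map_pow, map_ofNat]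
      have := eight_mul_red (4 ^ n * (red (c p.2) * red (y p) ^ (2 * m)))
      linear_combination this
  have hmem : ∀ p, t p ∈ 0 :: T := by
    intro p
    by_cases hp : x p ≠ 0 ∧ e p = e p₀
    · simp only [t, if_pos hp]
      exact List.mem_cons_of_mem _ (hT _ (isUnit_iff_isOdd.1 (hky p hp.1).1))
    · simp only [t, if_neg hp]
      exact List.mem_cons_self
  have hsum' : ∑ i, red (c i) * t (p₀.1, i) = 0 := by
    have h1 := congrArg (fun z => 2 * red z) hzero
    simp only [map_sum, map_zero, mul_zero, Finset.mul_sum, ht] at h1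
    rw [Fintype.sum_prod_type, Finset.sum_eq_single p₀.1] at h1
    · exact h1
    · intro j _ hj
      refine Finset.sum_eq_zero fun i _ => ?_
      have : ¬ (x (j, i) ≠ 0 ∧ e (j, i) = e p₀) := fun h => hj (heq (j, i) h.2)
      simp only [t, if_neg this, mul_zero]
    · exact fun h => absurd (Finset.mem_univ _) h
  have h := hc (fun i => t (p₀.1, i)) (fun i => hmem _) hsum' p₀.2
  have h1 : t p₀ ∈ T := by
    simp only [t, if_pos (show x p₀ ≠ 0 ∧ e p₀ = e p₀ from ⟨hp₀, rfl⟩)]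
    exact hT _ (isUnit_iff_isOdd.1 (hky p₀ hp₀).1)
  exact h0 (h ▸ h1)

theorem mul_add_one_le_gammaStar {m r : ℕ} (C : Fin r → GoldenMod) {T : List GoldenMod}
    (hT : ∀ q, IsOdd q → 2 * q ^ (2 * m) ∈ T) (h0 : 0 ∉ T)
    (hC : ∀ t : Fin r → GoldenMod, (∀ i, t i ∈ 0 :: T) → ∑ i, C i * t i = 0 → ∀ i, t i = 0) :
    ((m * r + 1 : ℕ) : ℕ∞) ≤ gammaStar (2 * m) Q2Sqrt5 := by
  choose c hc using fun i => red_surjective (C i)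
  obtain rfl : (fun i => red (c i)) = C := funext hc
  let a (p : Fin m × Fin r) : Q2Sqrt5 := 2 ^ (2 * (p.1 : ℕ)) * toField (c p.2)
  refine add_one_le_gammaStar (a := fun i => a (finProdFinEquiv.symm i)) ?_
  rintro ⟨x, hx, hsum⟩
  refine not_sum_eq_zero hT h0 hC (x := fun p => x (finProdFinEquiv p)) (fun h => hx ?_) ?_
  · funext i
    exact (congrArg x (Equiv.apply_symm_apply _ i)).symm.trans (congrFun h _)
  · rw [← hsum, ← finProdFinEquiv.sum_comp]
    simp [a]

/-- The unit group of `O / 4` is a product of `F₄ˣ`, of order `3`, and an elementary `2`-group, so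
it has exponent `6`. -/
theorem two_mul_pow_six : ∀ q, IsOdd q → 2 * q ^ 6 = 2 := forall_goldenMod (by decide +kernel)

theorem two_mul_pow_six_mul_add {q : GoldenMod} (hq : IsOdd q) (k l : ℕ) :
    2 * q ^ (6 * k + l) = 2 * q ^ l := by
  induction k with
  | zero => simp
  | succ k ih =>
    rw [← ih, show 6 * (k + 1) + l = 6 + (6 * k + l) by ring, pow_add q 6]
    linear_combination q ^ (6 * k + l) * two_mul_pow_six q hq

theorem le_gammaStar_of_not_dvd {m : ℕ} (h3 : ¬ 3 ∣ m) :
    ((m * 3 + 1 : ℕ) : ℕ∞) ≤ gammaStar (2 * m) Q2Sqrt5 := by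
  -- Since `1 + φ² + φ⁴` is divisible by `4`, the coefficients `1, 1, 1` would fail; `1 + 2φ`
  -- destroys this relation without creating another.
  refine mul_add_one_le_gammaStar ![1, 1, ⟨1, 2⟩] (T := [2, ⟨2, 2⟩, ⟨4, 6⟩]) ?_ (by decide +kernel) ?_
  · intro q hq
    have h2 : ∀ q, IsOdd q → 2 * q ^ 2 ∈ ([2, ⟨2, 2⟩, ⟨4, 6⟩] : List GoldenMod) :=
      forall_goldenMod (by decide +kernel)
    have h4 : ∀ q, IsOdd q → 2 * q ^ 4 ∈ ([2, ⟨2, 2⟩, ⟨4, 6⟩] : List GoldenMod) :=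
      forall_goldenMod (by decide +kernel)
    have hm : m = 3 * (m / 3) + 1 ∨ m = 3 * (m / 3) + 2 := by omega
    rcases hm with h | h
    · rw [h, show 2 * (3 * (m / 3) + 1) = 6 * (m / 3) + 2 by ring, two_mul_pow_six_mul_add hq]
      exact h2 q hq
    · rw [h, show 2 * (3 * (m / 3) + 2) = 6 * (m / 3) + 4 by ring, two_mul_pow_six_mul_add hq]
      exact h4 q hq
  · have key : ∀ x ∈ ([0, 2, ⟨2, 2⟩, ⟨4, 6⟩] : List GoldenMod),
        ∀ y ∈ ([0, 2, ⟨2, 2⟩, ⟨4, 6⟩] : List GoldenMod),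
        ∀ z ∈ ([0, 2, ⟨2, 2⟩, ⟨4, 6⟩] : List GoldenMod),
        1 * x + 1 * y + ⟨1, 2⟩ * z = 0 → x = 0 ∧ y = 0 ∧ z = 0 := by
      decide +kernel
    intro t ht hsum
    rw [Fin.sum_univ_three] at hsum
    obtain ⟨h0, h1, h2⟩ := key _ (ht 0) _ (ht 1) _ (ht 2) hsum
    intro i
    fin_cases i
    exacts [h0, h1, h2]

set_option synthInstance.maxSize 1000 in
set_option synthInstance.maxHeartbeats 200000 in
theorem le_gammaStar_of_dvd {m : ℕ} (h3 : 3 ∣ m) :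
    ((m * 6 + 1 : ℕ) : ℕ∞) ≤ gammaStar (2 * m) Q2Sqrt5 := by
  -- With `0` and `1` as the only powers modulo `4`, the values are `n + n' φ` with `0 ≤ n, n' ≤ 3`.
  refine mul_add_one_le_gammaStar ![1, 1, 1, ⟨0, 1⟩, ⟨0, 1⟩, ⟨0, 1⟩] (T := [2]) ?_
    (by decide +kernel) ?_
  · intro q hq
    obtain ⟨k, rfl⟩ := h3
    have := two_mul_pow_six_mul_add hq k 0
    rw [show 2 * (3 * k) = 6 * k + 0 by ring, this]
    simp
  · have key : ∀ x₀ ∈ ([0, 2] : List GoldenMod), ∀ x₁ ∈ ([0, 2] : List GoldenMod),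
        ∀ x₂ ∈ ([0, 2] : List GoldenMod), ∀ x₃ ∈ ([0, 2] : List GoldenMod),
        ∀ x₄ ∈ ([0, 2] : List GoldenMod), ∀ x₅ ∈ ([0, 2] : List GoldenMod),
        1 * x₀ + 1 * x₁ + 1 * x₂ + ⟨0, 1⟩ * x₃ + ⟨0, 1⟩ * x₄ + ⟨0, 1⟩ * x₅ = 0 →
          x₀ = 0 ∧ x₁ = 0 ∧ x₂ = 0 ∧ x₃ = 0 ∧ x₄ = 0 ∧ x₅ = 0 := by
      decide +kernel
    intro t ht hsum
    rw [Fin.sum_univ_six] at hsum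
    obtain ⟨h0, h1, h2, h3, h4, h5⟩ :=
      key _ (ht 0) _ (ht 1) _ (ht 2) _ (ht 3) _ (ht 4) _ (ht 5) hsum
    intro i
    fin_cases i
    exacts [h0, h1, h2, h3, h4, h5]

theorem mainTheorem1 (d m : ℕ) (hm : Odd m) (hm3 : 3 ≤ m) (hd : d = 2 * m) :
    (¬ 3 ∣ d → gammaStar d Q2Sqrt5 = ((3 * d / 2 + 1 : ℕ) : ℕ∞)) ∧
    (3 ∣ d → ((3 * d + 1 : ℕ) : ℕ∞) ≤ gammaStar d Q2Sqrt5 ∧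
      gammaStar d Q2Sqrt5 ≤ ((4 * d + 1 : ℕ) : ℕ∞)) := by
  subst hd
  refine ⟨fun h => ?_, fun h => ?_⟩
  · have h3 : ¬ 3 ∣ m := fun h' => h (h'.mul_left 2)
    rw [show 3 * (2 * m) / 2 = 3 * m by omega]
    refine le_antisymm (gammaStar_le fun t ht a => ?_) ?_
    · exact hasNontrivialZero_of_lt_of_not_dvd hm hm3 h3 ht a
    · rw [mul_comm 3 m]
      exact le_gammaStar_of_not_dvd h3
  · have h3 : 3 ∣ m := by omega
    refine ⟨?_, gammaStar_le fun t ht a => hasNontrivialZero_of_lt hm hm3 ht a⟩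
    rw [show 3 * (2 * m) = m * 6 by ring]
    exact le_gammaStar_of_dvd h3
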